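/- A reward-mixing MDP with two contexts (2RM-MDP) with finite state space $\mathcal S$, finite action space $\mathcal A$ and horizon $H$ consists of an initial distribution $\nu$ on $\mathcal S$, a transition kernel $T(\cdot\mid s,a)$, and two reward models $R_1,R_2$, where $R_m(\cdot\mid s,a)$ is a probability distribution on $\{0,1\}$. At the start of every episode a context $m\in\{1,2\}$ is drawn uniformly at random and is not observed; then, for $t=1,\dots,H$, the learner observes $s_t$ (where $s_1\sim\nu$, $s_{t+1}\sim T(\cdot\mid s_t,a_t)$), plays $a_t$ and receives $r_t\sim R_m(\cdot\mid s_t,a_t)$. A policy $\pi$ chooses $a_t$ as a function of $(s_i,a_i,r_i)_{i<t}$ and $s_t$; its value is $V^\pi=\frac12\sum_{m=1}^2\mathbb E_m^\pi\big[\sum_{t=1}^H r_t\big]$, and $\pi$ is $\varepsilon$-optimal if $\max_{\pi'}V^{\pi'}-V^{\pi}\le\varepsilon$. A (possibly randomized) algorithm interacts with an unknown instance for a number $\tau\in\{0,1,2,\dots\}\cup\{\infty\}$ of episodes, chosen adaptively by a stopping rule, and then returns a policy; it is $(\varepsilon,\eta)$-PAC on an instance if with probability at least $1-\eta$ it stops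 and returns an $\varepsilon$-optimal policy. **Theorem.** There are universal constants $c>0$ and $\varepsilon_0>0$ such that for all integers $S\ge 2$ and $A\ge 3$ there is a horizon $H\le 2\big(1+\lceil\log_A\lfloor S/2\rfloor\rceil\big)$ (so $H\le 2$ if $S=2$) with the following property. For every $0<\varepsilon\le\varepsilon_0$ there is a class $\mathcal C$ of 2RM-MDPs with $S$ states, $A$ actions and horizon $H$ such that, for every $0<\eta\le\frac14$ and every algorithm that is $(\varepsilon,\eta)$-PAC on all instances in $\mathcal C$, there is an instance in $\mathcal C$ on which the algorithm plays, with probability at least $\frac12$, at least $$c\,\frac{S^2A^2}{\varepsilon^2}$$ episodes. -/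

import Mathlib

open scoped ENNReal

noncomputable section

namespace RewardMixing

/-- A reward-mixing MDP with `M` contexts on the state space `𝒮` and the action space `𝒜`: the
initial distribution and the transition kernel are common, the (binary) reward model depends on the
latent context, which is drawn at the start of every episode from the mixing weights. -/
structure RMMDP (M : ℕ) (𝒮 𝒜 : Type) where
  /-- initial state distribution -/
  init : PMF 𝒮
  /-- transition probabilities -/
  trans : 𝒮 → 𝒜 → PMF 𝒮
  /-- mixing weights -/
  weight : PMF (Fin M)
  /-- reward models, one for each context; `true` is the reward 1 and `false` the reward 0 -/
  reward : Fin M → 𝒮 → 𝒜 → PMF Bool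

/-- The reward-mixing MDPs with two contexts, each of prior probability `1 / 2`. -/
def IsUniform2RM {𝒮 𝒜 : Type} (𝓜 : RMMDP 2 𝒮 𝒜) : Prop :=
  ∀ m, 𝓜.weight m = 1 / 2

/-- What is observed in (a part of) an episode: the visited states, actions and rewards, in order
of time. The latent context is not observed. -/
abbrev History (𝒮 𝒜 : Type) : Type := List (𝒮 × 𝒜 × Bool)

/-- History-dependent policies: the history of the episode and the current state determine the
action. -/
abbrev Policy (𝒮 𝒜 : Type) : Type := History 𝒮 𝒜 → 𝒮 → 𝒜

/-- Randomized history-dependent behaviour within an episode. -/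
abbrev Behaviour (𝒮 𝒜 : Type) : Type := History 𝒮 𝒜 → 𝒮 → PMF 𝒜

/-- A policy, as a behaviour that does not randomize. -/
def Policy.toBehaviour {𝒮 𝒜 : Type} (π : Policy 𝒮 𝒜) : Behaviour 𝒮 𝒜 :=
  fun h s => PMF.pure (π h s)

namespace RMMDP

variable {M : ℕ} {𝒮 𝒜 : Type}

/-- The law of the full history in the context `m` when `n` more steps are played with the
behaviour `β`, from the state `s` and after the history `h`. -/
def rollout (𝓜 : RMMDP M 𝒮 𝒜) (m : Fin M) (β : Behaviour 𝒮 𝒜) :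
    ℕ → History 𝒮 𝒜 → 𝒮 → PMF (History 𝒮 𝒜)
  | 0, h, _ => PMF.pure h
  | n + 1, h, s =>
    (β h s).bind fun a =>
      (𝓜.reward m s a).bind fun r =>
        (𝓜.trans s a).bind fun s' =>
          rollout 𝓜 m β n (h ++ [(s, a, r)]) s'

/-- The law of an episode of length `H` in the context `m`. -/
def episodeIn (𝓜 : RMMDP M 𝒮 𝒜) (H : ℕ) (m : Fin M) (β : Behaviour 𝒮 𝒜) : PMF (History 𝒮 𝒜) :=
  𝓜.init.bind fun s => 𝓜.rollout m β H [] s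

/-- The law of an episode of length `H`: the context is drawn from the mixing weights. -/
def episode (𝓜 : RMMDP M 𝒮 𝒜) (H : ℕ) (β : Behaviour 𝒮 𝒜) : PMF (History 𝒮 𝒜) :=
  𝓜.weight.bind fun m => 𝓜.episodeIn H m β

end RMMDP

/-- The sum of the rewards in a history. -/
def totalReward {𝒮 𝒜 : Type} (h : History 𝒮 𝒜) : ℕ :=
  (h.map fun x => if x.2.2 then 1 else 0).sum

namespace RMMDP

variable {M : ℕ} {𝒮 𝒜 : Type}

/-- The value of a policy: the mixture, over the contexts, of its expected total rewards. It is at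
most `H`. -/
def value (𝓜 : RMMDP M 𝒮 𝒜) (H : ℕ) (π : Policy 𝒮 𝒜) : ℝ≥0∞ :=
  ∑ m, 𝓜.weight m * ∑' h, 𝓜.episodeIn H m π.toBehaviour h * (totalReward h : ℝ≥0∞)

/-- The optimal value, over all history-dependent policies. -/
def optValue (𝓜 : RMMDP M 𝒮 𝒜) (H : ℕ) : ℝ≥0∞ :=
  ⨆ π : Policy 𝒮 𝒜, 𝓜.value H π

/-- `π` is `ε`-optimal: the optimal value exceeds its value by at most `ε`. -/
def IsEpsOptimal (𝓜 : RMMDP M 𝒮 𝒜) (H : ℕ) (ε : ℝ) (π : Policy 𝒮 𝒜) : Prop :=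
  𝓜.optValue H ≤ 𝓜.value H π + ENNReal.ofReal ε

end RMMDP

/-- A (possibly randomized) learning algorithm with an adaptive stopping rule. The first argument of
both fields is the list of all past episodes. -/
structure Algorithm (𝒮 𝒜 : Type) where
  /-- Between two episodes: stop and return the policy `π` (`some π`), or go on (`none`). -/
  decide : List (History 𝒮 𝒜) → PMF (Option (Policy 𝒮 𝒜))
  /-- The behaviour in the next episode. -/
  act : List (History 𝒮 𝒜) → Behaviour 𝒮 𝒜

namespace Algorithm

variable {M : ℕ} {𝒮 𝒜 : Type}

/-- The joint law of the episodes played so far and of the decision taken last, when `alg` interacts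
with `𝓜` and at most `K` episodes are played; once a policy is returned, nothing changes. -/
def run (alg : Algorithm 𝒮 𝒜) (𝓜 : RMMDP M 𝒮 𝒜) (H : ℕ) :
    ℕ → PMF (List (History 𝒮 𝒜) × Option (Policy 𝒮 𝒜))
  | 0 => (alg.decide []).bind fun o => PMF.pure ([], o)
  | K + 1 =>
    (run alg 𝓜 H K).bind fun x =>
      match x with
      | (hs, some π) => PMF.pure (hs, some π)
      | (hs, none) =>
        (𝓜.episode H (alg.act hs)).bind fun h =>
          (alg.decide (hs ++ [h])).bind fun o => PMF.pure (hs ++ [h], o)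

/-- The probability that `alg` plays more than `K` episodes. -/
def probMoreThan (alg : Algorithm 𝒮 𝒜) (𝓜 : RMMDP M 𝒮 𝒜) (H K : ℕ) : ℝ≥0∞ :=
  (alg.run 𝓜 H K).toOuterMeasure {x | x.2 = none}

/-- The probability that `alg` plays at most `K` episodes and returns an `ε`-optimal policy. -/
def probSuccessWithin (alg : Algorithm 𝒮 𝒜) (𝓜 : RMMDP M 𝒮 𝒜) (H : ℕ) (ε : ℝ) (K : ℕ) : ℝ≥0∞ :=
  (alg.run 𝓜 H K).toOuterMeasure {x | ∃ π, x.2 = some π ∧ 𝓜.IsEpsOptimal H ε π}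

/-- `alg` is `(ε, η)`-PAC on `𝓜`: with probability at least `1 - η` it stops, after any finite
number of episodes, and returns an `ε`-optimal policy. -/
def IsPAC (alg : Algorithm 𝒮 𝒜) (𝓜 : RMMDP M 𝒮 𝒜) (H : ℕ) (ε η : ℝ) : Prop :=
  ENNReal.ofReal (1 - η) ≤ ⨆ K, alg.probSuccessWithin 𝓜 H ε K

end Algorithm

end RewardMixing

end

noncomputable section

namespace RewardMixing

/-! The transitions are deterministic, and every episode plays at most one pair `x` of a set `first`
and then at most one pair `y` of a set `second`; both sets have order `S * A` elements. In the
instance of `(x, y)` the reward of `x` is 1 in one context and 0 in the other, the reward of `y` has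
mean `1 / 2 ± δ` with the sign given by the context, `δ = 8 * ε`, and all other rewards are fair
coins. Averaged over the contexts each single reward is fair, so only the correlation of the two
rewards carries information: relative to fair coins, the likelihood of an episode differs from 1
only if both `x` and `y` are played (`likelihood_pair`). An episode tests one of order `S ^ 2 * A ^
2` combinations, and detecting a bias `δ` takes order `1 / δ ^ 2` tests.

Values: a policy is worth `H / 2 + δ * gain` (`value_hardMean`), where the gain is the expectation,
under fair coins, of the sign of the first special reward on the event that the special steps are
`x, y`. The best gain is `1 / 2`: play `y` exactly when `x` paid 1 (`exists_le_gain`). The gains for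
two different combinations add up to at most `1 / 2` (`gain_add_gain_le`), whereas `ε`-optimality
forces a gain of `3 / 8`. Hence no policy is `ε`-optimal for two instances, and under the fair model
the success events of the instances have total probability at most 1.

Information: the instance is paired with its flip `-δ`. The two likelihoods of an episode multiply
to `1 - 4 * δ ^ 2` if `x, y` are played and to 1 otherwise, so by AM-GM their products over a run
sum to at least 2 minus `8 * δ ^ 2` times the number of such episodes (`two_mul_run_fairModel_le`).
Summing over all combinations (`card_mul_card_le`), the expected numbers of episodes add up to at
most `K`, and this bounds the number of combinations by a multiple of `ε ^ 2 * K + 1`. -/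

theorem toOuterMeasure_le_one {α : Type*} (p : PMF α) (s : Set α) : p.toOuterMeasure s ≤ 1 := by
  rw [PMF.toOuterMeasure_apply, ← p.tsum_coe]
  exact ENNReal.tsum_le_tsum fun x => Set.indicator_le_self _ _ _

theorem toOuterMeasure_compl_add {α : Type*} (p : PMF α) (s : Set α) :
    p.toOuterMeasure sᶜ + p.toOuterMeasure s = 1 := by
  rw [PMF.toOuterMeasure_apply, PMF.toOuterMeasure_apply, ← ENNReal.tsum_add, ← p.tsum_coe]
  refine tsum_congr fun x => ?_
  by_cases hx : x ∈ s <;> simp [hx]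

theorem sum_toOuterMeasure_le_one {α ι : Type*} (p : PMF α) (t : Finset ι) (E : ι → Set α)
    (hE : ∀ i ∈ t, ∀ j ∈ t, ∀ y, y ∈ E i → y ∈ E j → i = j) :
    ∑ i ∈ t, p.toOuterMeasure (E i) ≤ 1 := by
  classical
  simp only [PMF.toOuterMeasure_apply]
  rw [← Summable.tsum_finsetSum fun i _ => ENNReal.summable, ← p.tsum_coe]
  refine ENNReal.tsum_le_tsum fun y => ?_
  by_cases h : ∃ i ∈ t, y ∈ E i
  · obtain ⟨i, hi, hy⟩ := h
    rw [Finset.sum_eq_single_of_mem i hi fun j hj hji =>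
      Set.indicator_of_notMem (fun hyj => hji (hE j hj i hi y hyj hy)) _]
    exact Set.indicator_le_self _ _ _
  · rw [Finset.sum_eq_zero fun i hi =>
      Set.indicator_of_notMem (fun hy => h ⟨i, hi, hy⟩) _]
    exact zero_le

/-! ### Runs of an algorithm: stopping and change of measure -/

namespace Algorithm

variable {M : ℕ} {𝒮 𝒜 : Type}

/-- One more round of interaction. -/
def round (alg : Algorithm 𝒮 𝒜) (𝓜 : RMMDP M 𝒮 𝒜) (H : ℕ) :
    List (History 𝒮 𝒜) × Option (Policy 𝒮 𝒜) → PMF (List (History 𝒮 𝒜) × Option (Policy 𝒮 𝒜))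
  | (hs, some π) => PMF.pure (hs, some π)
  | (hs, none) =>
    (𝓜.episode H (alg.act hs)).bind fun h =>
      (alg.decide (hs ++ [h])).bind fun o => PMF.pure (hs ++ [h], o)

theorem run_succ (alg : Algorithm 𝒮 𝒜) (𝓜 : RMMDP M 𝒮 𝒜) (H K : ℕ) :
    alg.run 𝓜 H (K + 1) = (alg.run 𝓜 H K).bind (alg.round 𝓜 H) := by
  rw [run]
  congr 1

/-- Stopped outcomes are frozen, so an event consisting of stopped outcomes can only gain mass. -/
theorem run_toOuterMeasure_le_succ (alg : Algorithm 𝒮 𝒜) (𝓜 : RMMDP M 𝒮 𝒜) (H K : ℕ)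
    {E : Set (List (History 𝒮 𝒜) × Option (Policy 𝒮 𝒜))} (hE : ∀ y ∈ E, y.2 ≠ none) :
    (alg.run 𝓜 H K).toOuterMeasure E ≤ (alg.run 𝓜 H (K + 1)).toOuterMeasure E := by
  rw [run_succ, PMF.toOuterMeasure_bind_apply, PMF.toOuterMeasure_apply]
  refine ENNReal.tsum_le_tsum fun y => ?_
  by_cases hy : y ∈ E
  · rcases y with ⟨hs, _ | π⟩
    · exact absurd rfl (hE _ hy)
    · simp [hy, round]
  · simp [hy]

/-- Outcomes outside such an event have stopped and are frozen, so the event can only lose mass. -/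
theorem run_succ_toOuterMeasure_le (alg : Algorithm 𝒮 𝒜) (𝓜 : RMMDP M 𝒮 𝒜) (H K : ℕ)
    {E : Set (List (History 𝒮 𝒜) × Option (Policy 𝒮 𝒜))} (hE : ∀ y, y.2 = none → y ∈ E) :
    (alg.run 𝓜 H (K + 1)).toOuterMeasure E ≤ (alg.run 𝓜 H K).toOuterMeasure E := by
  rw [run_succ, PMF.toOuterMeasure_bind_apply, PMF.toOuterMeasure_apply]
  refine ENNReal.tsum_le_tsum fun y => ?_
  by_cases hy : y ∈ E
  · rw [Set.indicator_of_mem hy]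
    exact mul_le_of_le_one_right' (toOuterMeasure_le_one _ _)
  · rcases y with ⟨hs, _ | π⟩
    · exact absurd (hE _ rfl) hy
    · simp [hy, round]

theorem probMoreThan_antitone (alg : Algorithm 𝒮 𝒜) (𝓜 : RMMDP M 𝒮 𝒜) (H : ℕ) :
    Antitone (alg.probMoreThan 𝓜 H) :=
  antitone_nat_of_succ_le fun K => alg.run_succ_toOuterMeasure_le 𝓜 H K fun _ hy => hy

theorem probSuccessWithin_monotone (alg : Algorithm 𝒮 𝒜) (𝓜 : RMMDP M 𝒮 𝒜) (H : ℕ) (ε : ℝ) :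
    Monotone (alg.probSuccessWithin 𝓜 H ε) :=
  monotone_nat_of_le_succ fun K => alg.run_toOuterMeasure_le_succ 𝓜 H K fun y hy => by
    obtain ⟨π, h, -⟩ := hy
    simp [h]

/-- The eventual success probability is at most that within `K` episodes plus the probability of
playing more. -/
theorem iSup_probSuccessWithin_le (alg : Algorithm 𝒮 𝒜) (𝓜 : RMMDP M 𝒮 𝒜) (H : ℕ) (ε : ℝ)
    (K : ℕ) :
    ⨆ K', alg.probSuccessWithin 𝓜 H ε K' ≤
      alg.probSuccessWithin 𝓜 H ε K + alg.probMoreThan 𝓜 H K := by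
  set E : Set (List (History 𝒮 𝒜) × Option (Policy 𝒮 𝒜)) :=
    {x | ∃ π, x.2 = some π ∧ 𝓜.IsEpsOptimal H ε π} with hE
  set N : Set (List (History 𝒮 𝒜) × Option (Policy 𝒮 𝒜)) := {x | x.2 = none} with hN
  -- The union of success and non-stopping can only be left, namely by returning a bad policy.
  have hanti : Antitone fun j => (alg.run 𝓜 H j).toOuterMeasure (E ∪ N) :=
    antitone_nat_of_succ_le fun j =>
      alg.run_succ_toOuterMeasure_le 𝓜 H j fun y hy => Or.inr hy
  refine iSup_le fun K' => ?_
  calc alg.probSuccessWithin 𝓜 H ε K'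
      ≤ alg.probSuccessWithin 𝓜 H ε (max K K') :=
        alg.probSuccessWithin_monotone 𝓜 H ε (le_max_right _ _)
    _ ≤ (alg.run 𝓜 H (max K K')).toOuterMeasure (E ∪ N) :=
        MeasureTheory.measure_mono Set.subset_union_left
    _ ≤ (alg.run 𝓜 H K).toOuterMeasure (E ∪ N) := hanti (le_max_left _ _)
    _ ≤ _ := MeasureTheory.measure_union_le _ _

/-- At most `K` episodes are played within `K` rounds. -/
theorem length_le_of_mem_support_run (alg : Algorithm 𝒮 𝒜) (𝓜 : RMMDP M 𝒮 𝒜) (H K : ℕ)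
    {y : List (History 𝒮 𝒜) × Option (Policy 𝒮 𝒜)} (hy : y ∈ (alg.run 𝓜 H K).support) :
    y.1.length ≤ K := by
  induction K generalizing y with
  | zero =>
    rw [run] at hy
    simp only [PMF.mem_support_bind_iff, PMF.mem_support_pure_iff] at hy
    obtain ⟨o, -, rfl⟩ := hy
    simp
  | succ K ih =>
    rw [run_succ, PMF.mem_support_bind_iff] at hy
    obtain ⟨x, hx, hy⟩ := hy
    have := ih hx
    rcases x with ⟨hs, _ | π⟩
    · simp only [round, PMF.mem_support_bind_iff, PMF.mem_support_pure_iff] at hy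
      obtain ⟨h, -, o, -, rfl⟩ := hy
      simpa using this
    · simp only [round, PMF.mem_support_pure_iff] at hy
      subst hy
      exact this.trans (Nat.le_succ K)

/-- A property of all possible episodes holds for all episodes played. -/
theorem forall_mem_of_mem_support_run (alg : Algorithm 𝒮 𝒜) (𝓜 : RMMDP M 𝒮 𝒜) (H K : ℕ)
    {P : History 𝒮 𝒜 → Prop} (hP : ∀ β, ∀ h ∈ (𝓜.episode H β).support, P h)
    {y : List (History 𝒮 𝒜) × Option (Policy 𝒮 𝒜)} (hy : y ∈ (alg.run 𝓜 H K).support) :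
    ∀ h ∈ y.1, P h := by
  induction K generalizing y with
  | zero =>
    rw [run] at hy
    simp only [PMF.mem_support_bind_iff, PMF.mem_support_pure_iff] at hy
    obtain ⟨o, -, rfl⟩ := hy
    simp
  | succ K ih =>
    rw [run_succ, PMF.mem_support_bind_iff] at hy
    obtain ⟨x, hx, hy⟩ := hy
    have := ih hx
    rcases x with ⟨hs, _ | π⟩
    · simp only [round, PMF.mem_support_bind_iff, PMF.mem_support_pure_iff] at hy
      obtain ⟨h, hh, o, -, rfl⟩ := hy
      intro h' hh'
      rcases List.mem_append.1 hh' with hh' | hh'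
      · exact this h' hh'
      · rw [List.mem_singleton.1 hh']
        exact hP _ h hh
    · simp only [round, PMF.mem_support_pure_iff] at hy
      subst hy
      exact this

/-- If the episodes have a density between two models, so have the runs. -/
theorem run_eq_prod_mul (alg : Algorithm 𝒮 𝒜) (𝓜 𝓝 : RMMDP M 𝒮 𝒜) (H K : ℕ)
    {f : History 𝒮 𝒜 → ℝ≥0∞} (hf : ∀ β h, 𝓜.episode H β h = f h * 𝓝.episode H β h)
    (y : List (History 𝒮 𝒜) × Option (Policy 𝒮 𝒜)) :
    alg.run 𝓜 H K y = (y.1.map f).prod * alg.run 𝓝 H K y := by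
  induction K generalizing y with
  | zero =>
    rw [run, run, PMF.bind_apply, ← ENNReal.tsum_mul_left]
    refine tsum_congr fun o => ?_
    rw [PMF.pure_apply]
    split_ifs with h
    · simp [h]
    · simp
  | succ K ih =>
    rw [run_succ, run_succ, PMF.bind_apply, PMF.bind_apply, ← ENNReal.tsum_mul_left]
    refine tsum_congr fun x => ?_
    rw [ih x]
    rcases x with ⟨hs, _ | π⟩
    -- The algorithm's own kernels `act` and `decide` are common to both models, so a round
    -- contributes only the density of its new episode.
    · have : alg.round 𝓜 H (hs, none) y * (hs.map f).prod =
          (y.1.map f).prod * alg.round 𝓝 H (hs, none) y := by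
        simp only [round, PMF.bind_apply]
        rw [← ENNReal.tsum_mul_right, ← ENNReal.tsum_mul_left]
        refine tsum_congr fun h => ?_
        rw [hf, ← ENNReal.tsum_mul_left, ← ENNReal.tsum_mul_left, ← ENNReal.tsum_mul_left,
          ← ENNReal.tsum_mul_right]
        refine tsum_congr fun o => ?_
        rw [PMF.pure_apply]
        split_ifs with h'
        · simp only [h', List.map_append, List.prod_append, List.map_cons, List.map_nil,
            List.prod_singleton]
          ring
        · simp
      calc _ = alg.round 𝓜 H (hs, none) y * (hs.map f).prod * alg.run 𝓝 H K (hs, none) := by ring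
        _ = _ := by rw [this]; ring
    · simp only [round, PMF.pure_apply]
      split_ifs with h'
      · simp [h']
      · simp

/-- Eventual success has probability at least `3 / 4`, and less than `1 / 2` of it can come from
runs longer than `K`. -/
theorem quarter_le_probSuccessWithin (alg : Algorithm 𝒮 𝒜) (𝓜 : RMMDP M 𝒮 𝒜) {H K : ℕ}
    {ε η : ℝ} (hη : η ≤ 1 / 4) (hpac : alg.IsPAC 𝓜 H ε η) (hK : alg.probMoreThan 𝓜 H K < 1 / 2) :
    ENNReal.ofReal (1 / 4) ≤ alg.probSuccessWithin 𝓜 H ε K := by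
  have h2 : (1 / 2 : ℝ≥0∞) = ENNReal.ofReal (1 / 2) := by
    rw [ENNReal.ofReal_div_of_pos zero_lt_two]
    simp
  have h : ENNReal.ofReal (1 / 4) + ENNReal.ofReal (1 / 2) ≤
      alg.probSuccessWithin 𝓜 H ε K + ENNReal.ofReal (1 / 2) := by
    calc ENNReal.ofReal (1 / 4) + ENNReal.ofReal (1 / 2)
        = ENNReal.ofReal (1 / 4 + 1 / 2) := (ENNReal.ofReal_add (by norm_num) (by norm_num)).symm
      _ ≤ ENNReal.ofReal (1 - η) := ENNReal.ofReal_le_ofReal (by linarith)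
      _ ≤ _ := hpac
      _ ≤ _ := alg.iSup_probSuccessWithin_le 𝓜 H ε K
      _ ≤ _ := by
        rw [← h2]
        gcongr
  exact (ENNReal.add_le_add_iff_right ENNReal.ofReal_ne_top).1 h

end Algorithm

/-! ### Deterministic transitions and likelihoods relative to fair coins -/

variable {𝒮 𝒜 : Type}

/-- The law on `Bool` that gives the value `true` the probability `p`, truncated to `[0, 1]`. -/
def coin (p : ℝ) : PMF Bool :=
  PMF.ofFintype
    (fun b => ENNReal.ofReal (if b then max 0 (min p 1) else 1 - max 0 (min p 1))) (by
      have h1 : 0 ≤ 1 - max 0 (min p 1) := by simp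
      simp only [Fintype.sum_bool, if_true, Bool.false_eq_true, if_false]
      rw [← ENNReal.ofReal_add (le_max_left _ _) h1]
      simp)

theorem coin_apply {p : ℝ} (h0 : 0 ≤ p) (h1 : p ≤ 1) (b : Bool) :
    coin p b = ENNReal.ofReal (if b then p else 1 - p) := by
  simp [coin, h0, h1]

/-- The two-context model with deterministic transitions and the mean rewards `μ`. -/
def detModel (next : 𝒮 → 𝒜 → 𝒮) (start : 𝒮) (μ : Fin 2 → 𝒮 → 𝒜 → ℝ) : RMMDP 2 𝒮 𝒜 where
  init := PMF.pure start
  trans s a := PMF.pure (next s a)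
  weight := PMF.uniformOfFintype (Fin 2)
  reward m s a := coin (μ m s a)

/-- The model in which all rewards are fair coin flips. -/
def fairModel (next : 𝒮 → 𝒜 → 𝒮) (start : 𝒮) : RMMDP 2 𝒮 𝒜 :=
  detModel next start fun _ _ _ => 1 / 2

theorem isUniform2RM_detModel (next : 𝒮 → 𝒜 → 𝒮) (start : 𝒮) (μ : Fin 2 → 𝒮 → 𝒜 → ℝ) :
    IsUniform2RM (detModel next start μ) := fun m => by
  simp [detModel]

/-- The likelihood of the reward of a step in the context `m`, relative to a fair coin. -/
def stepWeight (μ : Fin 2 → 𝒮 → 𝒜 → ℝ) (m : Fin 2) (x : 𝒮 × 𝒜 × Bool) : ℝ :=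
  if x.2.2 then 2 * μ m x.1 x.2.1 else 2 * (1 - μ m x.1 x.2.1)

/-- The likelihood of the rewards of a history in the context `m`, relative to fair coins. -/
def histWeight (μ : Fin 2 → 𝒮 → 𝒜 → ℝ) (m : Fin 2) (h : History 𝒮 𝒜) : ℝ :=
  (h.map (stepWeight μ m)).prod

/-- The likelihood of the rewards of a history, relative to fair coins. -/
def likelihood (μ : Fin 2 → 𝒮 → 𝒜 → ℝ) (h : History 𝒮 𝒜) : ℝ :=
  (histWeight μ 0 h + histWeight μ 1 h) / 2

theorem stepWeight_nonneg {μ : Fin 2 → 𝒮 → 𝒜 → ℝ} (hμ : ∀ m s a, μ m s a ∈ Set.Icc (0 : ℝ) 1)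
    (m : Fin 2) (x : 𝒮 × 𝒜 × Bool) : 0 ≤ stepWeight μ m x := by
  have := hμ m x.1 x.2.1
  unfold stepWeight
  split_ifs <;> linarith [this.1, this.2]

theorem histWeight_nonneg {μ : Fin 2 → 𝒮 → 𝒜 → ℝ} (hμ : ∀ m s a, μ m s a ∈ Set.Icc (0 : ℝ) 1)
    (m : Fin 2) (h : History 𝒮 𝒜) : 0 ≤ histWeight μ m h :=
  List.prod_nonneg fun _ hx => by
    obtain ⟨x, -, rfl⟩ := List.mem_map.1 hx
    exact stepWeight_nonneg hμ m x

theorem likelihood_nonneg {μ : Fin 2 → 𝒮 → 𝒜 → ℝ} (hμ : ∀ m s a, μ m s a ∈ Set.Icc (0 : ℝ) 1)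
    (h : History 𝒮 𝒜) : 0 ≤ likelihood μ h :=
  div_nonneg (add_nonneg (histWeight_nonneg hμ 0 h) (histWeight_nonneg hμ 1 h)) zero_le_two

theorem histWeight_append_singleton (μ : Fin 2 → 𝒮 → 𝒜 → ℝ) (m : Fin 2) (h : History 𝒮 𝒜)
    (x : 𝒮 × 𝒜 × Bool) : histWeight μ m (h ++ [x]) = histWeight μ m h * stepWeight μ m x := by
  simp [histWeight]

theorem coin_eq_stepWeight_mul {μ : Fin 2 → 𝒮 → 𝒜 → ℝ}
    (hμ : ∀ m s a, μ m s a ∈ Set.Icc (0 : ℝ) 1) (m : Fin 2) (s : 𝒮) (a : 𝒜) (r : Bool) :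
    coin (μ m s a) r = ENNReal.ofReal (stepWeight μ m (s, a, r)) * coin (1 / 2) r := by
  rw [coin_apply (hμ m s a).1 (hμ m s a).2, coin_apply (by norm_num) (by norm_num),
    ← ENNReal.ofReal_mul (stepWeight_nonneg hμ _ _)]
  congr 1
  cases r <;> simp [stepWeight] <;> ring

/-- Weights on both sides make the change of measure an induction without division. The contexts `m`
and `m'` are independent because the fair model ignores the context. -/
theorem rollout_detModel (next : 𝒮 → 𝒜 → 𝒮) (start : 𝒮) {μ : Fin 2 → 𝒮 → 𝒜 → ℝ}
    (hμ : ∀ m s a, μ m s a ∈ Set.Icc (0 : ℝ) 1) (m m' : Fin 2) (β : Behaviour 𝒮 𝒜) (n : ℕ)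
    (h : History 𝒮 𝒜) (s : 𝒮) (h' : History 𝒮 𝒜) :
    ENNReal.ofReal (histWeight μ m h) * (detModel next start μ).rollout m β n h s h' =
      ENNReal.ofReal (histWeight μ m h') * (fairModel next start).rollout m' β n h s h' := by
  induction n generalizing h s with
  | zero =>
    simp only [RMMDP.rollout, PMF.pure_apply]
    split_ifs with hh
    · simp [hh]
    · simp
  | succ n ih =>
    simp only [RMMDP.rollout, detModel, fairModel, PMF.pure_bind, PMF.bind_apply]
    rw [← ENNReal.tsum_mul_left, ← ENNReal.tsum_mul_left]
    refine tsum_congr fun a => ?_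
    rw [mul_left_comm, mul_left_comm _ (β h s a)]
    refine congrArg _ ?_
    rw [← ENNReal.tsum_mul_left, ← ENNReal.tsum_mul_left]
    refine tsum_congr fun r => ?_
    have := ih (h ++ [(s, a, r)]) (next s a)
    rw [histWeight_append_singleton, ENNReal.ofReal_mul (histWeight_nonneg hμ m h)] at this
    rw [coin_eq_stepWeight_mul hμ]
    calc _ = coin (1 / 2) r * (ENNReal.ofReal (histWeight μ m h) *
          ENNReal.ofReal (stepWeight μ m (s, a, r)) *
          (detModel next start μ).rollout m β n (h ++ [(s, a, r)]) (next s a) h') := by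
          simp only [detModel]; ring
      _ = _ := by rw [this]; simp only [fairModel, detModel]; ring

theorem episodeIn_detModel (next : 𝒮 → 𝒜 → 𝒮) (start : 𝒮) {μ : Fin 2 → 𝒮 → 𝒜 → ℝ}
    (hμ : ∀ m s a, μ m s a ∈ Set.Icc (0 : ℝ) 1) (m : Fin 2) (H : ℕ) (β : Behaviour 𝒮 𝒜)
    (h : History 𝒮 𝒜) :
    (detModel next start μ).episodeIn H m β h =
      ENNReal.ofReal (histWeight μ m h) * (fairModel next start).rollout 0 β H [] start h := by
  rw [← rollout_detModel next start hμ m 0]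
  simp [RMMDP.episodeIn, detModel, histWeight]

theorem episode_detModel (next : 𝒮 → 𝒜 → 𝒮) (start : 𝒮) {μ : Fin 2 → 𝒮 → 𝒜 → ℝ}
    (hμ : ∀ m s a, μ m s a ∈ Set.Icc (0 : ℝ) 1) (H : ℕ) (β : Behaviour 𝒮 𝒜)
    (h : History 𝒮 𝒜) :
    (detModel next start μ).episode H β h =
      ENNReal.ofReal (likelihood μ h) * (fairModel next start).rollout 0 β H [] start h := by
  rw [RMMDP.episode, PMF.bind_apply, tsum_fintype, Fin.sum_univ_two, episodeIn_detModel _ _ hμ,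
    episodeIn_detModel _ _ hμ, isUniform2RM_detModel, isUniform2RM_detModel, ← mul_assoc,
    ← mul_assoc, ← add_mul, ← mul_add,
    ← ENNReal.ofReal_add (histWeight_nonneg hμ 0 h) (histWeight_nonneg hμ 1 h), likelihood,
    ENNReal.ofReal_div_of_pos zero_lt_two, ENNReal.ofReal_ofNat, ENNReal.div_eq_inv_mul,
    ENNReal.div_eq_inv_mul, mul_one]

theorem histWeight_fair (m : Fin 2) (h : History 𝒮 𝒜) :
    histWeight (fun _ _ _ => 1 / 2) m h = 1 := by
  refine List.prod_eq_one fun x hx => ?_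
  obtain ⟨y, -, rfl⟩ := List.mem_map.1 hx
  unfold stepWeight
  split_ifs <;> norm_num

theorem episode_fairModel (next : 𝒮 → 𝒜 → 𝒮) (start : 𝒮) (H : ℕ) (β : Behaviour 𝒮 𝒜) :
    (fairModel next start).episode H β = (fairModel next start).rollout 0 β H [] start := by
  ext h
  rw [fairModel, episode_detModel _ _ (fun _ _ _ => ⟨by norm_num, by norm_num⟩), fairModel]
  rw [likelihood, histWeight_fair, histWeight_fair]
  norm_num

/-! ### Values as expectations under fair coins -/

theorem tsum_bind_mul {α γ : Type*} (p : PMF α) (q : α → PMF γ) (f : γ → ℝ≥0∞) :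
    ∑' b, p.bind q b * f b = ∑' a, p a * ∑' b, q a b * f b := by
  simp only [PMF.bind_apply, ← ENNReal.tsum_mul_right, ← ENNReal.tsum_mul_left]
  rw [ENNReal.tsum_comm]
  simp only [mul_assoc]

theorem tsum_pure_mul {α : Type*} (a : α) (f : α → ℝ≥0∞) :
    ∑' b, PMF.pure a b * f b = f a := by
  rw [tsum_eq_single a fun b hb => by simp [PMF.pure_apply, hb]]
  simp

/-- The expectation of `F` of the final history, when `n` more steps are played with the policy
`π`, the transitions are deterministic and all rewards are fair coin flips. -/
def fairExp (next : 𝒮 → 𝒜 → 𝒮) (π : Policy 𝒮 𝒜) (F : History 𝒮 𝒜 → ℝ) :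
    ℕ → History 𝒮 𝒜 → 𝒮 → ℝ
  | 0, h, _ => F h
  | n + 1, h, s =>
    (fairExp next π F n (h ++ [(s, π h s, true)]) (next s (π h s)) +
      fairExp next π F n (h ++ [(s, π h s, false)]) (next s (π h s))) / 2

theorem fairExp_nonneg (next : 𝒮 → 𝒜 → 𝒮) (π : Policy 𝒮 𝒜) {F : History 𝒮 𝒜 → ℝ}
    (hF : ∀ h, 0 ≤ F h) (n : ℕ) (h : History 𝒮 𝒜) (s : 𝒮) : 0 ≤ fairExp next π F n h s := by
  induction n generalizing h s with
  | zero => exact hF h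
  | succ n ih => exact div_nonneg (add_nonneg (ih _ _) (ih _ _)) zero_le_two

theorem tsum_rollout_fairModel (next : 𝒮 → 𝒜 → 𝒮) (start : 𝒮) (m : Fin 2) (π : Policy 𝒮 𝒜)
    {F : History 𝒮 𝒜 → ℝ} (hF : ∀ h, 0 ≤ F h) (n : ℕ) (h : History 𝒮 𝒜) (s : 𝒮) :
    ∑' h', (fairModel next start).rollout m π.toBehaviour n h s h' * ENNReal.ofReal (F h') =
      ENNReal.ofReal (fairExp next π F n h s) := by
  induction n generalizing h s with
  | zero => exact tsum_pure_mul _ _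
  | succ n ih =>
    simp only [RMMDP.rollout, fairModel, detModel, PMF.pure_bind, Policy.toBehaviour] at ih ⊢
    rw [tsum_bind_mul, tsum_fintype, Fintype.sum_bool, ih, ih,
      coin_apply (by norm_num) (by norm_num), coin_apply (by norm_num) (by norm_num), fairExp,
      ← ENNReal.ofReal_mul (by norm_num), ← ENNReal.ofReal_mul (by norm_num),
      ← ENNReal.ofReal_add (mul_nonneg (by norm_num) (fairExp_nonneg _ _ hF _ _ _))
        (mul_nonneg (by norm_num) (fairExp_nonneg _ _ hF _ _ _))]
    congr 1
    norm_num
    ring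

/-- All values become expectations under one common law, in which the instance enters only through
the integrand. -/
theorem value_detModel (next : 𝒮 → 𝒜 → 𝒮) (start : 𝒮) {μ : Fin 2 → 𝒮 → 𝒜 → ℝ}
    (hμ : ∀ m s a, μ m s a ∈ Set.Icc (0 : ℝ) 1) (H : ℕ) (π : Policy 𝒮 𝒜) :
    (detModel next start μ).value H π =
      ENNReal.ofReal (fairExp next π (fun h => likelihood μ h * totalReward h) H [] start) := by
  rw [← tsum_rollout_fairModel next start 0 π
    (fun h => mul_nonneg (likelihood_nonneg hμ h) (Nat.cast_nonneg _))]
  have : (detModel next start μ).value H π =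
      ∑' h, (detModel next start μ).episode H π.toBehaviour h * (totalReward h : ℝ≥0∞) := by
    rw [RMMDP.episode, tsum_bind_mul, tsum_fintype, RMMDP.value]
  rw [this]
  refine tsum_congr fun h => ?_
  rw [episode_detModel _ _ hμ, ENNReal.ofReal_mul (likelihood_nonneg hμ h),
    ENNReal.ofReal_natCast]
  ring

theorem totalReward_append_singleton (h : History 𝒮 𝒜) (z : 𝒮 × 𝒜 × Bool) :
    totalReward (h ++ [z]) = totalReward h + if z.2.2 then 1 else 0 := by
  simp [totalReward]

/-- Expectations are compared along an invariant `I` of the play of `π` by means of a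
supermartingale `Z`. -/
theorem fairExp_le (next : 𝒮 → 𝒜 → 𝒮) (π : Policy 𝒮 𝒜) {F Z : History 𝒮 𝒜 → ℝ}
    {I : ℕ → History 𝒮 𝒜 → 𝒮 → Prop}
    (hI : ∀ n h s, I (n + 1) h s → ∀ r, I n (h ++ [(s, π h s, r)]) (next s (π h s)))
    (hZ : ∀ n h s, I (n + 1) h s →
      (Z (h ++ [(s, π h s, true)]) + Z (h ++ [(s, π h s, false)])) / 2 ≤ Z h)
    (hF : ∀ h s, I 0 h s → F h ≤ Z h) (n : ℕ) (h : History 𝒮 𝒜) (s : 𝒮) (hh : I n h s) :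
    fairExp next π F n h s ≤ Z h := by
  induction n generalizing h s with
  | zero => exact hF h s hh
  | succ n ih =>
    have h1 := ih _ _ (hI n h s hh true)
    have h2 := ih _ _ (hI n h s hh false)
    have h3 := hZ n h s hh
    rw [fairExp]
    linarith

theorem fairExp_add (next : 𝒮 → 𝒜 → 𝒮) (π : Policy 𝒮 𝒜) (F G : History 𝒮 𝒜 → ℝ) (n : ℕ)
    (h : History 𝒮 𝒜) (s : 𝒮) :
    fairExp next π (fun h => F h + G h) n h s = fairExp next π F n h s + fairExp next π G n h s := by
  induction n generalizing h s with
  | zero => rfl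
  | succ n ih =>
    simp only [fairExp, ih]
    ring

theorem fairExp_const_mul (next : 𝒮 → 𝒜 → 𝒮) (π : Policy 𝒮 𝒜) (c : ℝ) (F : History 𝒮 𝒜 → ℝ)
    (n : ℕ) (h : History 𝒮 𝒜) (s : 𝒮) :
    fairExp next π (fun h => c * F h) n h s = c * fairExp next π F n h s := by
  induction n generalizing h s with
  | zero => rfl
  | succ n ih =>
    simp only [fairExp, ih]
    ring

/-- An invariant of the play holds at the end of every possible episode. -/
theorem exists_of_mem_support_rollout (next : 𝒮 → 𝒜 → 𝒮) (start : 𝒮) (m : Fin 2)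
    (β : Behaviour 𝒮 𝒜) {I : ℕ → History 𝒮 𝒜 → 𝒮 → Prop}
    (hI : ∀ n h s, I (n + 1) h s → ∀ a r, I n (h ++ [(s, a, r)]) (next s a))
    (n : ℕ) (h : History 𝒮 𝒜) (s : 𝒮) (hh : I n h s) (h' : History 𝒮 𝒜)
    (hh' : h' ∈ ((fairModel next start).rollout m β n h s).support) : ∃ s', I 0 h' s' := by
  induction n generalizing h s with
  | zero =>
    rw [RMMDP.rollout, PMF.mem_support_pure_iff] at hh'
    exact ⟨s, hh' ▸ hh⟩
  | succ n ih =>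
    simp only [RMMDP.rollout, fairModel, detModel, PMF.pure_bind, PMF.mem_support_bind_iff] at hh'
    obtain ⟨a, -, r, -, hh'⟩ := hh'
    exact ih _ _ (hI n h s hh a r) hh'

/-! ### Two-stage layouts and the hard instances -/

/-- The state-action pair of a step. -/
def stepPair (z : 𝒮 × 𝒜 × Bool) : 𝒮 × 𝒜 := (z.1, z.2.1)

/-- The sign of a reward. -/
def rewardSign (r : Bool) : ℝ := if r then 1 else -1

/-- Deterministic transitions with two stages: every episode plays at most one of the state-action
pairs in `first`, and after it at most one of those in `second`. The predicates `before`, `between`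
and `after` on the number of remaining steps and the current state describe where in the episode
one is. Any pair in `first` and any in `second` can be played in the same episode. -/
structure Layout (𝒮 𝒜 : Type) where
  next : 𝒮 → 𝒜 → 𝒮
  start : 𝒮
  horizon : ℕ
  first : Finset (𝒮 × 𝒜)
  second : Finset (𝒮 × 𝒜)
  before : ℕ → 𝒮 → Prop
  between : ℕ → 𝒮 → Prop
  after : ℕ → 𝒮 → Prop
  disjoint : ∀ x ∈ first, x ∉ second
  before_start : before horizon start
  before_step : ∀ n s a, before (n + 1) s →
    (((s, a) ∉ first ∧ (s, a) ∉ second) ∧ before n (next s a)) ∨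
      ((s, a) ∈ first ∧ between n (next s a))
  between_step : ∀ n s a, between (n + 1) s →
    (((s, a) ∉ first ∧ (s, a) ∉ second) ∧ between n (next s a)) ∨
      ((s, a) ∈ second ∧ after n (next s a))
  after_step : ∀ n s a, after (n + 1) s →
    ((s, a) ∉ first ∧ (s, a) ∉ second) ∧ after n (next s a)
  reach : ∀ x ∈ first, ∀ y ∈ second, ∃ (g : 𝒮 → 𝒜) (u v : ℕ), u + v + 2 ≤ horizon ∧
    (∀ i < u, ((fun s => next s (g s))^[i] start, g ((fun s => next s (g s))^[i] start)) ∉ first) ∧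
    (fun s => next s (g s))^[u] start = x.1 ∧ g x.1 = x.2 ∧
    (∀ i < v, ((fun s => next s (g s))^[i] (next x.1 x.2),
      g ((fun s => next s (g s))^[i] (next x.1 x.2))) ∉ second) ∧
    (fun s => next s (g s))^[v] (next x.1 x.2) = y.1 ∧ g y.1 = y.2

variable [DecidableEq 𝒮] [DecidableEq 𝒜]

/-- The mean rewards of the hard instance: the reward of `x` reveals the context, and that of `y` is
biased by `δ` accordingly. -/
def hardMean (x y : 𝒮 × 𝒜) (δ : ℝ) (m : Fin 2) (s : 𝒮) (a : 𝒜) : ℝ :=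
  if (s, a) = x then (if m = 0 then 1 else 0)
  else if (s, a) = y then (if m = 0 then 1 / 2 + δ else 1 / 2 - δ)
  else 1 / 2

theorem hardMean_mem (x y : 𝒮 × 𝒜) {δ : ℝ} (hδ : |δ| ≤ 1 / 2) (m : Fin 2) (s : 𝒮) (a : 𝒜) :
    hardMean x y δ m s a ∈ Set.Icc (0 : ℝ) 1 := by
  have := abs_le.1 hδ
  unfold hardMean
  split_ifs <;> constructor <;> linarith [this.1, this.2]

/-- Whether the special steps are those with the pairs `x` and `y`. -/
def pairHit (x y : 𝒮 × 𝒜) : History 𝒮 𝒜 → ℕ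
  | [z, w] => if stepPair z = x ∧ stepPair w = y then 1 else 0
  | _ => 0

/-- The sign of the first reward if the special steps are those with the pairs `x` and `y`. -/
def pairSign (x y : 𝒮 × 𝒜) : History 𝒮 𝒜 → ℝ
  | [z, w] => if stepPair z = x ∧ stepPair w = y then rewardSign z.2.2 else 0
  | _ => 0

/-- The conditional probability, given the special steps so far, that the first special reward
is 1. -/
def firstRewardProb : History 𝒮 𝒜 → ℝ
  | [] => 1 / 2
  | z :: _ => if z.2.2 then 1 else 0

namespace Layout

variable (L : Layout 𝒮 𝒜)

/-- The special steps of a history. -/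
def special (h : History 𝒮 𝒜) : History 𝒮 𝒜 :=
  h.filter fun z => stepPair z ∈ L.first ∨ stepPair z ∈ L.second

theorem special_append_of_mem {s : 𝒮} {a : 𝒜} (hz : (s, a) ∈ L.first ∨ (s, a) ∈ L.second)
    (h : History 𝒮 𝒜) (r : Bool) :
    L.special (h ++ [(s, a, r)]) = L.special h ++ [(s, a, r)] := by
  simp [special, List.filter_append, stepPair, hz]

theorem special_append_of_notMem {s : 𝒮} {a : 𝒜} (hz : (s, a) ∉ L.first ∧ (s, a) ∉ L.second)
    (h : History 𝒮 𝒜) (r : Bool) : L.special (h ++ [(s, a, r)]) = L.special h := by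
  simp [special, List.filter_append, stepPair, hz]

/-- The stages of an episode. -/
def Stage (n : ℕ) (h : History 𝒮 𝒜) (s : 𝒮) : Prop :=
  (L.before n s ∧ L.special h = []) ∨
  (L.between n s ∧ ∃ z, stepPair z ∈ L.first ∧ L.special h = [z]) ∨
  (L.after n s ∧ ∃ z w, stepPair z ∈ L.first ∧ stepPair w ∈ L.second ∧ L.special h = [z, w])

theorem stage_start : L.Stage L.horizon [] L.start := Or.inl ⟨L.before_start, rfl⟩

theorem Stage.step {L : Layout 𝒮 𝒜} {n : ℕ} {h : History 𝒮 𝒜} {s : 𝒮} (hh : L.Stage (n + 1) h s)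
    (a : 𝒜) (r : Bool) : L.Stage n (h ++ [(s, a, r)]) (L.next s a) := by
  rcases hh with ⟨hb, hs⟩ | ⟨hb, z, hz, hs⟩ | ⟨hb, z, w, hz, hw, hs⟩
  · rcases L.before_step n s a hb with ⟨hn, hb⟩ | ⟨hm, hb⟩
    · exact Or.inl ⟨hb, by rw [L.special_append_of_notMem hn, hs]⟩
    · exact Or.inr (Or.inl ⟨hb, (s, a, r), hm, by
        rw [L.special_append_of_mem (Or.inl hm), hs, List.nil_append]⟩)
  · rcases L.between_step n s a hb with ⟨hn, hb⟩ | ⟨hm, hb⟩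
    · exact Or.inr (Or.inl ⟨hb, z, hz, by rw [L.special_append_of_notMem hn, hs]⟩)
    · exact Or.inr (Or.inr ⟨hb, z, (s, a, r), hz, hm, by
        rw [L.special_append_of_mem (Or.inr hm), hs, List.singleton_append]⟩)
  · obtain ⟨hn, hb⟩ := L.after_step n s a hb
    exact Or.inr (Or.inr ⟨hb, z, w, hz, hw, by
      rw [L.special_append_of_notMem hn, hs]⟩)

/-- The special steps of a possible history. -/
def Possible (h : History 𝒮 𝒜) : Prop :=
  L.special h = [] ∨ (∃ z, stepPair z ∈ L.first ∧ L.special h = [z]) ∨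
    ∃ z w, stepPair z ∈ L.first ∧ stepPair w ∈ L.second ∧ L.special h = [z, w]

theorem Stage.possible {L : Layout 𝒮 𝒜} {n : ℕ} {h : History 𝒮 𝒜} {s : 𝒮} (hh : L.Stage n h s) :
    L.Possible h :=
  hh.imp (fun h => h.2) (Or.imp (fun h => h.2) fun h => h.2)

theorem possible_of_mem_support (β : Behaviour 𝒮 𝒜) (h : History 𝒮 𝒜)
    (hh : h ∈ ((fairModel L.next L.start).episode L.horizon β).support) : L.Possible h := by
  rw [episode_fairModel] at hh
  obtain ⟨s, hs⟩ := exists_of_mem_support_rollout L.next L.start 0 β (I := L.Stage)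
    (fun n h s hs a r => hs.step a r) _ _ _ L.stage_start h hh
  exact hs.possible

/-! ### Likelihood of the hard instances -/

section Likelihood

variable {L} {x y : 𝒮 × 𝒜} (δ : ℝ)

theorem stepWeight_hardMean (x y : 𝒮 × 𝒜) (m : Fin 2) (z : 𝒮 × 𝒜 × Bool) :
    stepWeight (hardMean x y δ) m z =
      if stepPair z = x then (if m = 0 then 1 + rewardSign z.2.2 else 1 - rewardSign z.2.2)
      else if stepPair z = y then
        (if m = 0 then 1 + 2 * δ * rewardSign z.2.2 else 1 - 2 * δ * rewardSign z.2.2)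
      else 1 := by
  rcases z with ⟨s, a, r⟩
  cases r <;> simp only [stepWeight, hardMean, stepPair, rewardSign] <;> split_ifs <;> norm_num <;>
    first | contradiction | ring

theorem histWeight_special (hx : x ∈ L.first) (hy : y ∈ L.second) (m : Fin 2)
    (h : History 𝒮 𝒜) :
    histWeight (hardMean x y δ) m h = histWeight (hardMean x y δ) m (L.special h) := by
  induction h with
  | nil => rfl
  | cons z h ih =>
    have hc : histWeight (hardMean x y δ) m (z :: h) =
        stepWeight (hardMean x y δ) m z * histWeight (hardMean x y δ) m h := by
      simp [histWeight]
    rw [hc, ih]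
    by_cases hz : stepPair z ∈ L.first ∨ stepPair z ∈ L.second
    · have : L.special (z :: h) = z :: L.special h := by simp [special, hz]
      rw [this]
      simp [histWeight]
    · have : L.special (z :: h) = L.special h := by simp [special, hz]
      rw [this, stepWeight_hardMean, if_neg, if_neg, one_mul]
      · rintro rfl
        exact hz (Or.inr hy)
      · rintro rfl
        exact hz (Or.inl hx)

theorem likelihood_special (hx : x ∈ L.first) (hy : y ∈ L.second) (h : History 𝒮 𝒜) :
    likelihood (hardMean x y δ) h = likelihood (hardMean x y δ) (L.special h) := by
  rw [likelihood, likelihood, histWeight_special δ hx hy, histWeight_special δ hx hy 1]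

theorem likelihood_nil (x y : 𝒮 × 𝒜) : likelihood (hardMean x y δ) [] = 1 := by
  simp [likelihood, histWeight]

/-- The two contexts give `1 ± 1` at `x`, which averages to 1: the first special reward alone is
uninformative. -/
theorem likelihood_singleton (hy : y ∈ L.second) {z : 𝒮 × 𝒜 × Bool}
    (hz : stepPair z ∈ L.first) : likelihood (hardMean x y δ) [z] = 1 := by
  have : stepPair z ≠ y := fun h => L.disjoint _ hz (h ▸ hy)
  simp only [likelihood, histWeight, List.map_cons, List.map_nil, List.prod_singleton,
    stepWeight_hardMean, this, if_false]
  split_ifs <;> norm_num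
  contradiction

/-- At `x` one context has weight 2 and the other 0, so the reward of `x` selects the sign of the
bias at `y`. If `x` or `y` is missing, the contexts average out to 1. -/
theorem likelihood_pair (hx : x ∈ L.first) (hy : y ∈ L.second) {z w : 𝒮 × 𝒜 × Bool}
    (hz : stepPair z ∈ L.first) (hw : stepPair w ∈ L.second) :
    likelihood (hardMean x y δ) [z, w] =
      1 + 2 * δ * (pairSign x y [z, w] * rewardSign w.2.2) := by
  have h1 : stepPair z ≠ y := fun h => L.disjoint _ hz (h ▸ hy)
  have h2 : stepPair w ≠ x := fun h => L.disjoint _ hx (h ▸ hw)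
  simp only [likelihood, histWeight, List.map_cons, List.map_nil, List.prod_cons, List.prod_nil,
    stepWeight_hardMean, h1, h2, if_false, pairSign]
  by_cases h3 : stepPair z = x <;> by_cases h4 : stepPair w = y <;> (simp [h3, h4]; try ring)

theorem pairHit_eq (x y : 𝒮 × 𝒜) (z w : 𝒮 × 𝒜 × Bool) :
    (pairHit x y [z, w] : ℝ) = (pairSign x y [z, w] * rewardSign w.2.2) ^ 2 := by
  simp only [pairHit, pairSign, rewardSign]
  split_ifs <;> norm_num

/-- With `σ` the product of the two reward signs this is `(1 + 2δσ)(1 - 2δσ)`: the term of first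
order in `δ` cancels, which yields the rate `1 / ε ^ 2`. -/
theorem likelihood_mul_likelihood_neg (hx : x ∈ L.first) (hy : y ∈ L.second)
    {h : History 𝒮 𝒜} (hh : L.Possible h) :
    likelihood (hardMean x y δ) h * likelihood (hardMean x y (-δ)) h =
      1 - 4 * δ ^ 2 * pairHit x y (L.special h) := by
  rw [likelihood_special δ hx hy, likelihood_special (-δ) hx hy]
  rcases hh with hs | ⟨z, hz, hs⟩ | ⟨z, w, hz, hw, hs⟩
  · simp [hs, likelihood_nil, pairHit]
  · rw [hs, likelihood_singleton δ hy hz, likelihood_singleton (-δ) hy hz]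
    simp [pairHit]
  · rw [hs, likelihood_pair δ hx hy hz hw, likelihood_pair (-δ) hx hy hz hw, pairHit_eq]
    ring

end Likelihood

/-! ### Indistinguishability from the fair model -/

theorem pairHit_le_one (x y : 𝒮 × 𝒜) (h : History 𝒮 𝒜) : pairHit x y h ≤ 1 := by
  unfold pairHit
  split
  · split_ifs <;> simp
  · simp

/-- A list with exactly two steps determines its combination of pairs, and any other list hits none.
-/
theorem sum_pairHit_le_one (h : History 𝒮 𝒜) (s : Finset ((𝒮 × 𝒜) × (𝒮 × 𝒜))) :
    ∑ p ∈ s, pairHit p.1 p.2 h ≤ 1 := by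
  unfold pairHit
  split
  · rename_i z w
    calc _ = ∑ p ∈ s, if (stepPair z, stepPair w) = p then 1 else 0 := by
          refine Finset.sum_congr rfl fun p _ => ?_
          simp [Prod.ext_iff]
      _ ≤ 1 := by
          rw [Finset.sum_ite_eq]
          split_ifs <;> simp
  · simp

theorem sum_map_pairHit_le (hs : List (History 𝒮 𝒜)) (s : Finset ((𝒮 × 𝒜) × (𝒮 × 𝒜))) :
    ∑ p ∈ s, (hs.map fun h => pairHit p.1 p.2 (L.special h)).sum ≤ hs.length := by
  induction hs with
  | nil => simp
  | cons h hs ih =>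
    simp only [List.map_cons, List.sum_cons, Finset.sum_add_distrib, List.length_cons]
    have := sum_pairHit_le_one (L.special h) s
    omega

/-- Two nonnegative products whose factors multiply to almost 1 sum up to almost 2. -/
theorem two_le_prod_add_prod {α : Type*} {f g : α → ℝ} {k : α → ℕ} {c : ℝ} (hc0 : 0 ≤ c)
    (hc1 : c ≤ 1) (hs : List α) (hf : ∀ h ∈ hs, 0 ≤ f h) (hg : ∀ h ∈ hs, 0 ≤ g h)
    (hk : ∀ h ∈ hs, k h ≤ 1) (hfg : ∀ h ∈ hs, f h * g h = 1 - c * k h) :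
    2 ≤ (hs.map f).prod + (hs.map g).prod + 2 * c * (hs.map k).sum := by
  -- Bernoulli's inequality. The bound of the product by 1 is carried along for the induction, and
  -- because it gives `√(PQ) ≥ PQ` in the final AM-GM step.
  have key : 0 ≤ (hs.map f).prod ∧ 0 ≤ (hs.map g).prod ∧
      (hs.map f).prod * (hs.map g).prod ≤ 1 ∧
      1 - c * (hs.map k).sum ≤ (hs.map f).prod * (hs.map g).prod := by
    induction hs with
    | nil => simp
    | cons h hs ih =>
      obtain ⟨i1, i2, i3, i4⟩ := ih (fun a ha => hf a (List.mem_cons_of_mem _ ha))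
        (fun a ha => hg a (List.mem_cons_of_mem _ ha))
        (fun a ha => hk a (List.mem_cons_of_mem _ ha))
        (fun a ha => hfg a (List.mem_cons_of_mem _ ha))
      have j1 := hf h List.mem_cons_self
      have j2 := hg h List.mem_cons_self
      have j3 : (k h : ℝ) ≤ 1 := by exact_mod_cast hk h List.mem_cons_self
      have j4 := hfg h List.mem_cons_self
      have j5 : c * k h ≤ 1 := (mul_le_mul hc1 j3 (Nat.cast_nonneg _) zero_le_one).trans (by simp)
      have j6 : 0 ≤ c * k h := mul_nonneg hc0 (Nat.cast_nonneg _)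
      simp only [List.map_cons, List.prod_cons, List.sum_cons]
      have e : f h * (hs.map f).prod * (g h * (hs.map g).prod) =
          (1 - c * k h) * ((hs.map f).prod * (hs.map g).prod) := by
        rw [← j4]; ring
      have hp := mul_nonneg i1 i2
      refine ⟨mul_nonneg j1 i1, mul_nonneg j2 i2, ?_, ?_⟩
      · rw [e]; nlinarith
      · rw [e, Nat.cast_add]; nlinarith [mul_nonneg j6 (sub_nonneg.2 i3)]
  obtain ⟨i1, i2, i3, i4⟩ := key
  set P := (hs.map f).prod
  set Q := (hs.map g).prod
  have hPQ := mul_nonneg i1 i2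
  have : 2 * (P * Q) ≤ P + Q :=
    abs_le_of_sq_le_sq' (by nlinarith [sq_nonneg (P - Q)]) (add_nonneg i1 i2) |>.2
  nlinarith

/-- The hard instances are hard to distinguish from the fair model unless their pair is played. -/
theorem two_mul_run_fairModel_le (alg : Algorithm 𝒮 𝒜) (K : ℕ) {x y : 𝒮 × 𝒜} (hx : x ∈ L.first)
    (hy : y ∈ L.second) {δ : ℝ} (hδ : |δ| ≤ 1 / 2)
    (E : Set (List (History 𝒮 𝒜) × Option (Policy 𝒮 𝒜))) :
    2 * (alg.run (fairModel L.next L.start) L.horizon K).toOuterMeasure E ≤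
      (alg.run (detModel L.next L.start (hardMean x y δ)) L.horizon K).toOuterMeasure E +
      (alg.run (detModel L.next L.start (hardMean x y (-δ))) L.horizon K).toOuterMeasure E +
      ENNReal.ofReal (8 * δ ^ 2) * ∑' o, alg.run (fairModel L.next L.start) L.horizon K o *
        ((o.1.map fun h => pairHit x y (L.special h)).sum : ℕ) := by
  have hδ' : |(-δ)| ≤ 1 / 2 := by rwa [abs_neg]
  have hdens : ∀ d : ℝ, |d| ≤ 1 / 2 → ∀ o,
      alg.run (detModel L.next L.start (hardMean x y d)) L.horizon K o =
      (o.1.map fun h => ENNReal.ofReal (likelihood (hardMean x y d) h)).prod *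
        alg.run (fairModel L.next L.start) L.horizon K o := fun d hd o =>
    alg.run_eq_prod_mul _ _ _ K (fun β h => by
      rw [episode_detModel _ _ (hardMean_mem x y hd), episode_fairModel]) o
  have hprod : ∀ d : ℝ, |d| ≤ 1 / 2 → ∀ hs : List (History 𝒮 𝒜),
      (hs.map fun h => ENNReal.ofReal (likelihood (hardMean x y d) h)).prod =
        ENNReal.ofReal (hs.map (likelihood (hardMean x y d))).prod := by
    intro d hd hs
    induction hs with
    | nil => simp
    | cons h hs ih =>
      rw [List.map_cons, List.prod_cons, ih, List.map_cons, List.prod_cons,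
        ENNReal.ofReal_mul (likelihood_nonneg (hardMean_mem x y hd) h)]
  have hnn : ∀ d : ℝ, |d| ≤ 1 / 2 → ∀ hs : List (History 𝒮 𝒜),
      0 ≤ (hs.map (likelihood (hardMean x y d))).prod := fun d hd hs =>
    List.prod_nonneg fun _ ha => by
      obtain ⟨h, -, rfl⟩ := List.mem_map.1 ha
      exact likelihood_nonneg (hardMean_mem x y hd) h
  have hδ2 : δ ^ 2 ≤ 1 / 4 := by
    have := abs_le.1 hδ
    nlinarith [this.1, this.2]
  rw [PMF.toOuterMeasure_apply, PMF.toOuterMeasure_apply, PMF.toOuterMeasure_apply,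
    ← ENNReal.tsum_mul_left, ← ENNReal.tsum_mul_left, ← ENNReal.tsum_add, ← ENNReal.tsum_add]
  refine ENNReal.tsum_le_tsum fun o => ?_
  by_cases hE : o ∈ E
  swap
  · simp [hE]
  -- Off the support the left side vanishes; on it all episodes are possible, as the product
  -- identity of the likelihoods requires.
  by_cases ho : o ∈ (alg.run (fairModel L.next L.start) L.horizon K).support
  swap
  · rw [PMF.mem_support_iff, not_not] at ho
    simp [hE, ho]
  have hposs := alg.forall_mem_of_mem_support_run _ _ K L.possible_of_mem_support ho
  have := two_le_prod_add_prod (f := likelihood (hardMean x y δ))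
    (g := likelihood (hardMean x y (-δ))) (k := fun h => pairHit x y (L.special h))
    (c := 4 * δ ^ 2) (by positivity) (by linarith) o.1
    (fun h _ => likelihood_nonneg (hardMean_mem x y hδ) h)
    (fun h _ => likelihood_nonneg (hardMean_mem x y hδ') h)
    (fun h _ => pairHit_le_one _ _ _)
    (fun h hh => likelihood_mul_likelihood_neg δ hx hy (hposs h hh))
  rw [Set.indicator_of_mem hE, Set.indicator_of_mem hE, Set.indicator_of_mem hE, hdens δ hδ,
    hdens (-δ) hδ', hprod δ hδ, hprod (-δ) hδ']
  have h2 : (2 : ℝ≥0∞) ≤ ENNReal.ofReal (o.1.map (likelihood (hardMean x y δ))).prod +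
      ENNReal.ofReal (o.1.map (likelihood (hardMean x y (-δ)))).prod +
      ENNReal.ofReal (8 * δ ^ 2) * ((o.1.map fun h => pairHit x y (L.special h)).sum : ℕ) := by
    rw [← ENNReal.ofReal_natCast, ← ENNReal.ofReal_mul (by positivity),
      ← ENNReal.ofReal_add (hnn _ hδ _) (hnn _ hδ' _),
      ← ENNReal.ofReal_add (add_nonneg (hnn _ hδ _) (hnn _ hδ' _)) (by positivity)]
    calc (2 : ℝ≥0∞) = ENNReal.ofReal 2 := by simp
      _ ≤ _ := ENNReal.ofReal_le_ofReal (by linarith)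
  calc _ ≤ _ := mul_le_mul_left h2 _
    _ = _ := by ring

/-! ### Values and near-optimal policies of the hard instances -/

/-- The total reward expected from the fair continuation of a history, weighted with its
likelihood and compensated for the gain from the correlation of the rewards of `x` and `y`. -/
def compensated (x y : 𝒮 × 𝒜) (δ : ℝ) (h : History 𝒮 𝒜) : ℝ :=
  likelihood (hardMean x y δ) h * (totalReward h + (L.horizon - h.length : ℝ) / 2) -
    δ * pairSign x y (L.special h)

/-- The likelihood and the reward are correlated only when `y` is played after `x`. There the
averaged product grows by an extra `δ` times the sign of the first reward, which is the subtracted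
term; every other step earns `1 / 2` on average. -/
theorem compensated_step {x y : 𝒮 × 𝒜} (hx : x ∈ L.first) (hy : y ∈ L.second) (δ : ℝ) {n : ℕ}
    {h : History 𝒮 𝒜} {s : 𝒮} (hh : L.Stage (n + 1) h s) (a : 𝒜) :
    (L.compensated x y δ (h ++ [(s, a, true)]) + L.compensated x y δ (h ++ [(s, a, false)])) / 2 =
      L.compensated x y δ h := by
  simp only [compensated, totalReward_append_singleton, List.length_append,
    List.length_singleton]
  rw [likelihood_special δ hx hy (h ++ _), likelihood_special δ hx hy (h ++ [(s, a, false)]),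
    likelihood_special δ hx hy h]
  have stay (hn : (s, a) ∉ L.first ∧ (s, a) ∉ L.second) (r : Bool) :
      L.special (h ++ [(s, a, r)]) = L.special h := L.special_append_of_notMem hn h r
  rcases hh with ⟨hb, hs⟩ | ⟨hb, z, hz, hs⟩ | ⟨hb, z, w, hz, hw, hs⟩
  · rcases L.before_step n s a hb with ⟨hn, hb⟩ | ⟨hm, hb⟩
    · rw [stay hn, stay hn]
      push_cast
      simp
      ring
    · rw [L.special_append_of_mem (Or.inl hm), L.special_append_of_mem (Or.inl hm), hs,
        List.nil_append, List.nil_append, likelihood_singleton δ hy (by exact hm),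
        likelihood_singleton δ hy (by exact hm), likelihood_nil]
      simp [pairSign]
      ring
  · rcases L.between_step n s a hb with ⟨hn, hb⟩ | ⟨hm, hb⟩
    · rw [stay hn, stay hn]
      push_cast
      simp
      ring
    · rw [L.special_append_of_mem (Or.inr hm), L.special_append_of_mem (Or.inr hm), hs,
        List.singleton_append, List.singleton_append, likelihood_pair δ hx hy hz (by exact hm),
        likelihood_pair δ hx hy hz (by exact hm), likelihood_singleton δ hy hz]
      have e : pairSign x y [z, (s, a, true)] = pairSign x y [z, (s, a, false)] := rfl
      have e' : pairSign x y [z] = 0 := rfl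
      rw [e, e']
      simp only [rewardSign]
      push_cast
      simp
      ring
  · obtain ⟨hn, hb⟩ := L.after_step n s a hb
    rw [stay hn, stay hn]
    push_cast
    simp
    ring

/-- The probability that the first special reward is 1 is a martingale. -/
theorem firstRewardProb_step (h : History 𝒮 𝒜) (s : 𝒮) (a : 𝒜) :
    (firstRewardProb (L.special (h ++ [(s, a, true)])) +
      firstRewardProb (L.special (h ++ [(s, a, false)]))) / 2 = firstRewardProb (L.special h) := by
  by_cases ha : (s, a) ∈ L.first ∨ (s, a) ∈ L.second
  · rw [L.special_append_of_mem ha, L.special_append_of_mem ha]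
    rcases L.special h with _ | ⟨z, l⟩ <;> simp [firstRewardProb]
  · rw [not_or] at ha
    rw [L.special_append_of_notMem ha, L.special_append_of_notMem ha]
    simp

/-- The expected gain from the correlation. -/
def gain (x y : 𝒮 × 𝒜) (π : Policy 𝒮 𝒜) : ℝ :=
  fairExp L.next π (fun h => pairSign x y (L.special h)) L.horizon [] L.start

theorem value_hardMean {x y : 𝒮 × 𝒜} (hx : x ∈ L.first) (hy : y ∈ L.second) {δ : ℝ}
    (hδ : |δ| ≤ 1 / 2) (π : Policy 𝒮 𝒜) :
    (detModel L.next L.start (hardMean x y δ)).value L.horizon π =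
      ENNReal.ofReal (L.horizon / 2 + δ * L.gain x y π) := by
  rw [value_detModel _ _ (hardMean_mem x y hδ)]
  congr 1
  set F : History 𝒮 𝒜 → ℝ := fun h =>
    likelihood (hardMean x y δ) h * totalReward h + -δ * pairSign x y (L.special h) with hF
  -- The length is part of the invariant since the term for the remaining steps must vanish at the
  -- end.
  have hend : ∀ h s, (L.Stage 0 h s ∧ h.length + 0 = L.horizon) → F h = L.compensated x y δ h := by
    rintro h s ⟨-, hl⟩
    simp only [hF, compensated, ← hl]
    push_cast
    ring
  have hI : ∀ n h s, (L.Stage (n + 1) h s ∧ h.length + (n + 1) = L.horizon) → ∀ r,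
      L.Stage n (h ++ [(s, π h s, r)]) (L.next s (π h s)) ∧
        (h ++ [(s, π h s, r)]).length + n = L.horizon := by
    rintro n h s ⟨hh, hl⟩ r
    exact ⟨hh.step _ r, by simp; omega⟩
  have hstart : L.compensated x y δ [] = L.horizon / 2 := by
    simp [compensated, special, pairSign, totalReward, likelihood_nil]
  have h1 : fairExp L.next π F L.horizon [] L.start ≤ L.compensated x y δ [] :=
    fairExp_le L.next π (I := fun n h s => L.Stage n h s ∧ h.length + n = L.horizon) hI
      (fun n h s hh => (L.compensated_step hx hy δ hh.1 _).le) (fun h s hh => (hend h s hh).le)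
      _ _ _ ⟨L.stage_start, by simp⟩
  -- The comparison lemma for the negated martingale gives the reverse inequality.
  have h2 : fairExp L.next π (fun h => -1 * F h) L.horizon [] L.start ≤
      -1 * L.compensated x y δ [] :=
    fairExp_le L.next π (I := fun n h s => L.Stage n h s ∧ h.length + n = L.horizon)
      (Z := fun h => -1 * L.compensated x y δ h) hI
      (fun n h s hh => by have := L.compensated_step hx hy δ hh.1 (π h s); linarith)
      (fun h s hh => by rw [hend h s hh]) _ _ _ ⟨L.stage_start, by simp⟩
  rw [fairExp_const_mul] at h2
  have h3 : fairExp L.next π F L.horizon [] L.start =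
      fairExp L.next π (fun h => likelihood (hardMean x y δ) h * totalReward h) L.horizon []
        L.start + -δ * L.gain x y π := by
    rw [hF, fairExp_add, fairExp_const_mul, gain]
  linarith

/-- No policy exploits two pairs. -/
theorem gain_add_gain_le {x y x' y' : 𝒮 × 𝒜} (hne : (x, y) ≠ (x', y')) (π : Policy 𝒮 𝒜) :
    L.gain x y π + L.gain x' y' π ≤ 1 / 2 := by
  rw [gain, gain, ← fairExp_add]
  refine fairExp_le L.next π (Z := fun h => firstRewardProb (L.special h)) (I := L.Stage)
    (fun n h s hh r => hh.step _ r) (fun n h s _ => (L.firstRewardProb_step h s _).le) ?_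
    _ _ _ L.stage_start
  intro h s hh
  rcases hh.possible with hs | ⟨z, -, hs⟩ | ⟨z, w, -, -, hs⟩
  · simp [hs, pairSign, firstRewardProb]
  · simp only [hs, pairSign, firstRewardProb]
    split_ifs <;> norm_num
  · simp only [hs, pairSign, firstRewardProb, rewardSign]
    split_ifs with h1 h2 h3 <;> try norm_num
    exact hne (by rw [← h1.1, ← h1.2, ← h3.1, ← h3.2])

/-- Some policy exploits a given pair. -/
theorem exists_le_gain [Nontrivial 𝒜] {x y : 𝒮 × 𝒜} (hx : x ∈ L.first) (hy : y ∈ L.second) :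
    ∃ π, 1 / 2 ≤ L.gain x y π := by
  obtain ⟨g, u, v, huv, hu, hux, gx, hv, hvy, gy⟩ := L.reach x hx y hy
  obtain ⟨b, hb⟩ := exists_ne y.2
  set f : 𝒮 → 𝒮 := fun s => L.next s (g s) with hf
  -- Follow the route through `x` and `y`, but at the state of `y` deviate to `b` if `x` paid 0.
  set π : Policy 𝒮 𝒜 := fun h s => if s = y.1 ∧ (x.1, x.2, false) ∈ L.special h then b else g s
    with hπ
  refine ⟨π, ?_⟩
  -- The five cases: on the way to `x`; `x` paid 1 and the way to `y` is ahead; both played; `x`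
  -- paid 0; `x` paid 0 and a second special pair other than `y` was played. The step counts exclude
  -- the first two at the end.
  let I : ℕ → History 𝒮 𝒜 → 𝒮 → Prop := fun n h s =>
    (L.before n s ∧ L.special h = [] ∧ ∃ u, u + v + 2 ≤ n ∧
      (∀ i < u, (f^[i] s, g (f^[i] s)) ∉ L.first) ∧ f^[u] s = x.1) ∨
    (L.between n s ∧ L.special h = [(x.1, x.2, true)] ∧ ∃ v, v + 1 ≤ n ∧
      (∀ i < v, (f^[i] s, g (f^[i] s)) ∉ L.second) ∧ f^[v] s = y.1) ∨
    (L.after n s ∧ ∃ r, L.special h = [(x.1, x.2, true), (y.1, y.2, r)]) ∨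
    (L.between n s ∧ L.special h = [(x.1, x.2, false)]) ∨
    (L.after n s ∧ ∃ w, stepPair w ≠ y ∧ L.special h = [(x.1, x.2, false), w])
  have hI : ∀ n h s, I (n + 1) h s → ∀ r, I n (h ++ [(s, π h s, r)]) (L.next s (π h s)) := by
    rintro n h s (⟨hb, hs, u, hun, hu, hux⟩ | ⟨hb, hs, v, hvn, hv, hvy⟩ | ⟨hb, r', hs⟩ | ⟨hb, hs⟩ |
      ⟨hb, w, hw, hs⟩) r
    · have hg : π h s = g s := by simp [hπ, hs]
      rw [hg]
      rcases u with _ | u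
      · simp only [Function.iterate_zero, id_eq] at hux
        subst hux
        rw [gx]
        rcases L.before_step n x.1 x.2 hb with ⟨hn, -⟩ | ⟨-, hb⟩
        · exact absurd hx hn.1
        · have hs' : L.special (h ++ [(x.1, x.2, r)]) = [(x.1, x.2, r)] := by
            rw [L.special_append_of_mem (Or.inl hx), hs, List.nil_append]
          cases r
          · exact Or.inr (Or.inr (Or.inr (Or.inl ⟨hb, hs'⟩)))
          · exact Or.inr (Or.inl ⟨hb, hs', v, by omega, hv, hvy⟩)
      · rcases L.before_step n s (g s) hb with ⟨hn, hb⟩ | ⟨hm, -⟩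
        · exact Or.inl ⟨hb, by rw [L.special_append_of_notMem hn, hs], u, by omega,
            fun i hi => hu (i + 1) (by omega), hux⟩
        · exact absurd hm (hu 0 (by omega))
    · have hg : π h s = g s := by simp [hπ, hs]
      rw [hg]
      rcases v with _ | v
      · simp only [Function.iterate_zero, id_eq] at hvy
        subst hvy
        rw [gy]
        rcases L.between_step n y.1 y.2 hb with ⟨hn, -⟩ | ⟨-, hb⟩
        · exact absurd hy hn.2
        · exact Or.inr (Or.inr (Or.inl ⟨hb, r, by
            rw [L.special_append_of_mem (Or.inr hy), hs, List.singleton_append]⟩))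
      · rcases L.between_step n s (g s) hb with ⟨hn, hb⟩ | ⟨hm, -⟩
        · exact Or.inr (Or.inl ⟨hb, by rw [L.special_append_of_notMem hn, hs], v, by omega,
            fun i hi => hv (i + 1) (by omega), hvy⟩)
        · exact absurd hm (hv 0 (by omega))
    · obtain ⟨hn, hb⟩ := L.after_step n s (π h s) hb
      exact Or.inr (Or.inr (Or.inl ⟨hb, r', by rw [L.special_append_of_notMem hn, hs]⟩))
    · rcases L.between_step n s (π h s) hb with ⟨hn, hb⟩ | ⟨hm, hb⟩
      · exact Or.inr (Or.inr (Or.inr (Or.inl ⟨hb, by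
          rw [L.special_append_of_notMem hn, hs]⟩)))
      · refine Or.inr (Or.inr (Or.inr (Or.inr ⟨hb, (s, π h s, r), ?_, by
          rw [L.special_append_of_mem (Or.inr hm), hs, List.singleton_append]⟩)))
        rintro hsy
        rw [stepPair, Prod.ext_iff] at hsy
        simp only at hsy
        have : π h s = b := by simp [hπ, hs, hsy.1]
        exact ‹b ≠ y.2› (this ▸ hsy.2)
    · obtain ⟨hn, hb⟩ := L.after_step n s (π h s) hb
      exact Or.inr (Or.inr (Or.inr (Or.inr ⟨hb, w, hw, by
        rw [L.special_append_of_notMem hn, hs]⟩)))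
  have hstart : L.Stage L.horizon [] L.start ∧ I L.horizon [] L.start :=
    ⟨L.stage_start, Or.inl ⟨L.before_start, rfl, u, huv, hu, hux⟩⟩
  -- Negation turns the upper bound into a lower one; in the three possible final cases `pairSign`
  -- and `firstRewardProb` agree.
  have := fairExp_le L.next π (F := fun h => -1 * pairSign x y (L.special h))
    (Z := fun h => -1 * firstRewardProb (L.special h))
    (I := fun n h s => L.Stage n h s ∧ I n h s)
    (fun n h s hh r => ⟨hh.1.step _ r, hI n h s hh.2 r⟩)
    (fun n h s _ => by have := L.firstRewardProb_step h s (π h s); linarith) (by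
      rintro h s ⟨-, ⟨-, -, u, hu, -⟩ | ⟨-, -, v, hv, -⟩ | ⟨-, r, hs⟩ | ⟨-, hs⟩ | ⟨-, w, hw, hs⟩⟩
      · omega
      · omega
      · simp [hs, pairSign, firstRewardProb, stepPair, rewardSign]
      · simp [hs, pairSign, firstRewardProb]
      · simp [hs, pairSign, firstRewardProb, hw]) _ _ _ hstart
  rw [fairExp_const_mul] at this
  have h1 : firstRewardProb (L.special []) = 1 / 2 := rfl
  rw [h1] at this
  rw [gain]
  linarith

/-- With `δ = 8 * ε`, a loss of `ε` in value is a loss of `1 / 8` in gain, from the attainable `1 /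
2`. -/
theorem le_gain_of_isEpsOptimal [Nontrivial 𝒜] {x y : 𝒮 × 𝒜} (hx : x ∈ L.first)
    (hy : y ∈ L.second) {ε : ℝ} (hε : 0 < ε) (hε' : ε ≤ 1 / 16) {π : Policy 𝒮 𝒜}
    (hπ : (detModel L.next L.start (hardMean x y (8 * ε))).IsEpsOptimal L.horizon ε π) :
    3 / 8 ≤ L.gain x y π := by
  have hδ : |8 * ε| ≤ 1 / 2 := by rw [abs_of_pos (by positivity)]; linarith
  obtain ⟨π', hπ'⟩ := L.exists_le_gain hx hy
  have h1 : (detModel L.next L.start (hardMean x y (8 * ε))).value L.horizon π' ≤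
      (detModel L.next L.start (hardMean x y (8 * ε))).value L.horizon π + ENNReal.ofReal ε :=
    (le_iSup _ π').trans hπ
  rw [L.value_hardMean hx hy hδ, L.value_hardMean hx hy hδ] at h1
  have hH : (0 : ℝ) ≤ L.horizon := Nat.cast_nonneg _
  -- `ENNReal.ofReal` truncates negative numbers, so the sign has to be split; the negative case is
  -- contradictory.
  have hnn : 0 ≤ (L.horizon : ℝ) / 2 + 8 * ε * L.gain x y π ∨
      (L.horizon : ℝ) / 2 + 8 * ε * L.gain x y π < 0 := le_or_gt _ _
  rcases hnn with hnn | hnn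
  · rw [← ENNReal.ofReal_add hnn hε.le, ENNReal.ofReal_le_ofReal_iff (by linarith)] at h1
    nlinarith
  · rw [ENNReal.ofReal_of_nonpos hnn.le, zero_add, ENNReal.ofReal_le_ofReal_iff hε.le] at h1
    nlinarith

theorem not_isEpsOptimal_of_isEpsOptimal [Nontrivial 𝒜] {x y x' y' : 𝒮 × 𝒜} (hx : x ∈ L.first)
    (hy : y ∈ L.second) (hx' : x' ∈ L.first) (hy' : y' ∈ L.second) (hne : (x, y) ≠ (x', y'))
    {ε : ℝ} (hε : 0 < ε) (hε' : ε ≤ 1 / 16) {π : Policy 𝒮 𝒜}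
    (hπ : (detModel L.next L.start (hardMean x y (8 * ε))).IsEpsOptimal L.horizon ε π) :
    ¬ (detModel L.next L.start (hardMean x' y' (8 * ε))).IsEpsOptimal L.horizon ε π := fun hπ' => by
  have h1 := L.le_gain_of_isEpsOptimal hx hy hε hε' hπ
  have h2 := L.le_gain_of_isEpsOptimal hx' hy' hε hε' hπ'
  have h3 := L.gain_add_gain_le hne π
  linarith

/-- The hard instances for the precision `ε`. -/
def hardModel (ε : ℝ) (x y : 𝒮 × 𝒜) : RMMDP 2 𝒮 𝒜 :=
  detModel L.next L.start (hardMean x y (8 * ε))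

/-- An algorithm that is successful on all hard instances needs many episodes on one of them. -/
theorem card_mul_card_le [Nontrivial 𝒜] (alg : Algorithm 𝒮 𝒜) {ε η : ℝ} (hε : 0 < ε)
    (hε' : ε ≤ 1 / 16) (hη : η ≤ 1 / 4) (K : ℕ)
    (hpac : ∀ x ∈ L.first, ∀ y ∈ L.second, alg.IsPAC (L.hardModel ε x y) L.horizon ε η)
    (hK : ∀ x ∈ L.first, ∀ y ∈ L.second,
      alg.probMoreThan (L.hardModel ε x y) L.horizon K < 1 / 2) :
    (L.first.card * L.second.card : ℝ) / 4 ≤ 512 * ε ^ 2 * K + 2 := by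
  have hδ : |8 * ε| ≤ 1 / 2 := by rw [abs_of_pos (by positivity)]; linarith
  set R₀ := alg.run (fairModel L.next L.start) L.horizon K with hR₀
  set t := L.first ×ˢ L.second with ht
  let E : (𝒮 × 𝒜) × (𝒮 × 𝒜) → Set (List (History 𝒮 𝒜) × Option (Policy 𝒮 𝒜)) := fun p =>
    {o | ∃ π, o.2 = some π ∧ (L.hardModel ε p.1 p.2).IsEpsOptimal L.horizon ε π}
  let V : (𝒮 × 𝒜) × (𝒮 × 𝒜) → ℝ≥0∞ := fun p =>
    ∑' o, R₀ o * ((o.1.map fun h => pairHit p.1 p.2 (L.special h)).sum : ℕ)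
  have hmem : ∀ p ∈ t, p.1 ∈ L.first ∧ p.2 ∈ L.second := fun p hp => Finset.mem_product.1 hp
  have hE : ∑ p ∈ t, R₀.toOuterMeasure (E p) ≤ 1 := by
    refine sum_toOuterMeasure_le_one R₀ t E fun p hp q hq o hop hoq => ?_
    obtain ⟨π, hπ, hopt⟩ := hop
    obtain ⟨π', hπ', hopt'⟩ := hoq
    obtain rfl : π = π' := Option.some.inj (hπ.symm.trans hπ')
    by_contra hne
    exact L.not_isEpsOptimal_of_isEpsOptimal (hmem p hp).1 (hmem p hp).2 (hmem q hq).1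
      (hmem q hq).2 hne hε hε' hopt hopt'
  have hV : ∑ p ∈ t, V p ≤ K := by
    rw [← Summable.tsum_finsetSum fun i _ => ENNReal.summable]
    calc _ ≤ ∑' o, R₀ o * K := by
          refine ENNReal.tsum_le_tsum fun o => ?_
          by_cases ho : o ∈ R₀.support
          · rw [← Finset.mul_sum, ← Nat.cast_sum]
            gcongr
            exact (L.sum_map_pairHit_le o.1 t).trans (alg.length_le_of_mem_support_run _ _ _ ho)
          · rw [PMF.mem_support_iff, not_not] at ho
            simp [ho]
      _ = K := by rw [ENNReal.tsum_mul_right, R₀.tsum_coe, one_mul]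
  have hp : ∀ p ∈ t, ENNReal.ofReal (1 / 4) ≤
      ENNReal.ofReal (8 * (8 * ε) ^ 2) * V p + 2 * R₀.toOuterMeasure (E p) := by
    intro p hp
    obtain ⟨h1, h2⟩ := hmem p hp
    have hs : ENNReal.ofReal (1 / 4) ≤
        (alg.run (L.hardModel ε p.1 p.2) L.horizon K).toOuterMeasure (E p) :=
      alg.quarter_le_probSuccessWithin _ hη (hpac _ h1 _ h2) (hK _ h1 _ h2)
    have hinfo := L.two_mul_run_fairModel_le alg K h1 h2 hδ (E p)ᶜ
    have hc := toOuterMeasure_compl_add (alg.run (L.hardModel ε p.1 p.2) L.horizon K) (E p)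
    have hc₀ := toOuterMeasure_compl_add R₀ (E p)
    -- The flipped instance is not among the hard ones and nothing is assumed on it; the trivial
    -- bound 1 is enough.
    have hflip := toOuterMeasure_le_one
      (alg.run (detModel L.next L.start (hardMean p.1 p.2 (-(8 * ε)))) L.horizon K) (E p)ᶜ
    -- Adding 2 to both sides replaces the subtraction of probabilities in `ℝ≥0∞`.
    refine (ENNReal.add_le_add_iff_left (a := 2) (by simp)).1 ?_
    calc 2 + ENNReal.ofReal (1 / 4)
        = 2 * R₀.toOuterMeasure (E p)ᶜ + 2 * R₀.toOuterMeasure (E p) + ENNReal.ofReal (1 / 4) := by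
          rw [← mul_add, hc₀, mul_one]
      _ ≤ ((alg.run (L.hardModel ε p.1 p.2) L.horizon K).toOuterMeasure (E p)ᶜ + 1 +
          ENNReal.ofReal (8 * (8 * ε) ^ 2) * V p) + 2 * R₀.toOuterMeasure (E p) +
          (alg.run (L.hardModel ε p.1 p.2) L.horizon K).toOuterMeasure (E p) := by
          gcongr
          exact hinfo.trans (by gcongr; exact le_rfl)
      _ = ((alg.run (L.hardModel ε p.1 p.2) L.horizon K).toOuterMeasure (E p)ᶜ +
          (alg.run (L.hardModel ε p.1 p.2) L.horizon K).toOuterMeasure (E p)) + 1 +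
          (ENNReal.ofReal (8 * (8 * ε) ^ 2) * V p + 2 * R₀.toOuterMeasure (E p)) := by ring
      _ = _ := by rw [hc, one_add_one_eq_two]
  have hsum := Finset.sum_le_sum hp
  rw [Finset.sum_const, Finset.sum_add_distrib, ← Finset.mul_sum, ← Finset.mul_sum] at hsum
  have hfin : ENNReal.ofReal ((L.first.card * L.second.card : ℝ) / 4) ≤
      ENNReal.ofReal (512 * ε ^ 2 * K + 2) := by
    calc _ = t.card • ENNReal.ofReal (1 / 4) := by
          rw [ht, Finset.card_product, nsmul_eq_mul, ← ENNReal.ofReal_natCast,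
            ← ENNReal.ofReal_mul (Nat.cast_nonneg _)]
          push_cast
          congr 1
          ring
      _ ≤ _ := hsum
      _ ≤ ENNReal.ofReal (8 * (8 * ε) ^ 2) * K + 2 * 1 := by gcongr
      _ = _ := by
        rw [ENNReal.ofReal_add (by positivity) zero_le_two,
          ENNReal.ofReal_mul (p := 512 * ε ^ 2) (by positivity), ENNReal.ofReal_natCast, mul_one,
          ENNReal.ofReal_ofNat, show 8 * (8 * ε) ^ 2 = 512 * ε ^ 2 by ring]
  exact (ENNReal.ofReal_le_ofReal_iff (by positivity)).1 hfin

end Layout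

/-! ### Heaps: a layout with many special pairs -/

theorem iterate_eq_of_forall_lt {α : Type*} {f f' : α → α} {s : α} {t : ℕ}
    (h : ∀ j < t, f' (f^[j] s) = f (f^[j] s)) : ∀ j ≤ t, f'^[j] s = f^[j] s := by
  intro j hj
  induction j with
  | zero => rfl
  | succ j ih =>
    rw [Function.iterate_succ_apply', Function.iterate_succ_apply', ih (by omega), h j (by omega)]

variable {S A : ℕ}

/-- The states `o, …, o + n - 1` form an `A`-ary heap, in which the action `a` leads from the
node `i` to its child `A * i + a + 1`, if this is a node. -/
def IsHeap (next : Fin S → Fin A → Fin S) (o n : ℕ) : Prop :=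
  ∀ s a, o ≤ s.val → s.val < o + n → A * (s.val - o) + a.val + 1 < n →
    (next s a).val = o + (A * (s.val - o) + a.val + 1)

/-- The state-action pairs that leave a heap. -/
def heapExits (S A o n : ℕ) : Finset (Fin S × Fin A) :=
  Finset.univ.filter fun p =>
    o ≤ p.1.val ∧ p.1.val < o + n ∧ n ≤ A * (p.1.val - o) + p.2.val + 1

theorem mem_heapExits {o n : ℕ} {p : Fin S × Fin A} : p ∈ heapExits S A o n ↔
    o ≤ p.1.val ∧ p.1.val < o + n ∧ n ≤ A * (p.1.val - o) + p.2.val + 1 := by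
  simp [heapExits]

/-- The child indices `A * i + a + 1` run through `1, …, n * A`, and those from `n` on are not
nodes; division with remainder recovers `i` and `a`. -/
theorem le_card_heapExits {o n : ℕ} (hA : 0 < A) (hn : o + n ≤ S) (hn' : 0 < n) :
    n * A + 1 - n ≤ (heapExits S A o n).card := by
  rw [← Nat.card_Icc]
  refine Finset.card_le_card_of_surjOn
    (fun p : Fin S × Fin A => A * (p.1.val - o) + p.2.val + 1) fun k hk => ?_
  rw [Finset.coe_Icc, Set.mem_Icc] at hk
  have hdiv : (k - 1) / A < n := by
    rw [Nat.div_lt_iff_lt_mul hA]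
    omega
  have hmod : A * ((k - 1) / A) + (k - 1) % A = k - 1 := Nat.div_add_mod _ _
  have hlt : (k - 1) % A < A := Nat.mod_lt _ hA
  generalize (k - 1) / A = i at hdiv hmod
  generalize (k - 1) % A = a at hmod hlt
  refine ⟨(⟨o + i, by omega⟩, ⟨a, hlt⟩), ?_, ?_⟩
  · rw [Finset.mem_coe, mem_heapExits]
    simp only [Nat.add_sub_cancel_left]
    omega
  · simp only [Nat.add_sub_cancel_left]
    omega

/-- Every action at every node of a heap can be reached from the root, without leaving the heap
before. -/
theorem IsHeap.exists_path {next : Fin S → Fin A → Fin S} {o n : ℕ} (hheap : IsHeap next o n)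
    {root : Fin S} (hroot : root.val = o) (d : ℕ) :
    ∀ (i : Fin S) (b : Fin A), o ≤ i.val → i.val < o + n → i.val - o < A ^ d →
    ∃ (g : Fin S → Fin A) (t : ℕ), t ≤ d ∧ (fun s => next s (g s))^[t] root = i ∧ g i = b ∧
      ∀ j < t, o ≤ ((fun s => next s (g s))^[j] root).val ∧
        ((fun s => next s (g s))^[j] root).val < i.val ∧
        ((fun s => next s (g s))^[j] root, g ((fun s => next s (g s))^[j] root)) ∉
          heapExits S A o n := by
  induction d with
  | zero =>
    intro i b ho _ hd
    refine ⟨fun _ => b, 0, le_rfl, ?_, rfl, by simp⟩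
    rw [pow_zero] at hd
    exact Fin.ext (by simp only [Function.iterate_zero, id_eq]; omega)
  | succ d ih =>
    intro i b ho hn hd
    have hA : 0 < A := b.pos
    rcases Nat.eq_zero_or_pos (i.val - o) with hi | hi
    · refine ⟨fun _ => b, 0, Nat.zero_le _, ?_, rfl, by simp⟩
      exact Fin.ext (by simp only [Function.iterate_zero, id_eq]; omega)
    have hdm : A * ((i.val - o - 1) / A) + (i.val - o - 1) % A = i.val - o - 1 :=
      Nat.div_add_mod _ _
    have hp : (i.val - o - 1) / A ≤ i.val - o - 1 := Nat.div_le_self _ _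
    have hpd : (i.val - o - 1) / A < A ^ d := by
      rw [Nat.div_lt_iff_lt_mul hA, ← pow_succ]
      omega
    set p : Fin S := ⟨o + (i.val - o - 1) / A, by have := i.isLt; omega⟩ with hpdef
    set a : Fin A := ⟨(i.val - o - 1) % A, Nat.mod_lt _ hA⟩ with hadef
    have hpv : p.val - o = (i.val - o - 1) / A := by simp [hpdef]
    have hpi : p.val < i.val := by simp only [hpdef]; omega
    have hpo : o ≤ p.val := by simp [hpdef]
    have hkid : A * (p.val - o) + a.val + 1 = i.val - o := by
      rw [hpv]
      simp only [hadef]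
      omega
    obtain ⟨g, t, ht, hgt, hga, hpath⟩ := ih p a hpo (by omega) (by rwa [hpv])
    set f : Fin S → Fin S := fun s => next s (g s) with hf
    -- Indices increase along the path, so prescribing the action at `i` leaves the route to its
    -- parent intact.
    have hne : ∀ s : Fin S, s.val < i.val → Function.update g i b s = g s := fun s hs =>
      Function.update_of_ne (by rintro rfl; exact lt_irrefl _ hs) _ _
    have hcongr := iterate_eq_of_forall_lt (f := f)
      (f' := fun s => next s (Function.update g i b s)) (s := root) (t := t) fun j hj => by
        rw [hf]
        simp only
        rw [hne _ ((hpath j hj).2.1.trans hpi)]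
    refine ⟨Function.update g i b, t + 1, by omega, ?_, Function.update_self _ _ _, ?_⟩
    · rw [Function.iterate_succ_apply', hcongr t le_rfl, hgt, hne _ hpi, hga]
      refine Fin.ext ?_
      rw [hheap p a hpo (by omega) (by omega)]
      omega
    · intro j hj
      rw [hcongr j (by omega)]
      rcases Nat.lt_or_ge j t with hjt | hjt
      · obtain ⟨h1, h2, h3⟩ := hpath j hjt
        rw [hne _ (h2.trans hpi)]
        exact ⟨h1, h2.trans hpi, h3⟩
      · obtain rfl : j = t := by omega
        rw [hgt, hne _ hpi, hga]
        refine ⟨hpo, hpi, fun hmem => ?_⟩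
        rw [mem_heapExits] at hmem
        have := hmem.2.2
        simp only at this
        omega

/-- The size of the second heap. -/
def secondSize (S : ℕ) : ℕ := max 1 (S - 1 - S / 2)

/-- The transitions: two heaps one after the other, and then the last state. -/
def heapNext (hS : 2 ≤ S) (s : Fin S) (a : Fin A) : Fin S :=
  if h1 : s.val < S / 2 then
    if h2 : A * s.val + a.val + 1 < S / 2 then ⟨A * s.val + a.val + 1, by omega⟩
    else ⟨S / 2, by omega⟩
  else
    if h2 : s.val < S / 2 + secondSize S ∧ A * (s.val - S / 2) + a.val + 1 < secondSize S then
      ⟨S / 2 + (A * (s.val - S / 2) + a.val + 1), by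
        have := h2.2
        simp only [secondSize] at this
        omega⟩
    else ⟨S - 1, by omega⟩

theorem isHeap_first (hS : 2 ≤ S) : IsHeap (heapNext (A := A) hS) 0 (S / 2) := by
  intro s a _ h1 h2
  rw [Nat.zero_add] at h1
  rw [Nat.sub_zero] at h2 ⊢
  simp [heapNext, h1, h2]

theorem isHeap_second (hS : 2 ≤ S) :
    IsHeap (heapNext (A := A) hS) (S / 2) (secondSize S) := by
  intro s a h0 h1 h2
  simp [heapNext, h1, h2, not_lt.2 h0]

/-- The two heaps as a layout. -/
def heapLayout (hS : 2 ≤ S) (hA : 3 ≤ A) : Layout (Fin S) (Fin A) where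
  next := heapNext hS
  start := ⟨0, by omega⟩
  horizon := 2 * (1 + Nat.clog A (S / 2))
  first := heapExits S A 0 (S / 2)
  second := heapExits S A (S / 2) (secondSize S)
  -- For `S ≥ 3` the last state lies outside both heaps and is absorbing. For `S = 2` it is also the
  -- only node of the second heap; then the horizon is 2, and the number of remaining steps tells
  -- the stages apart.
  before n s := s.val < S / 2 ∧ (S = 2 → n = 2)
  between n s := S / 2 ≤ s.val ∧ s.val < S / 2 + secondSize S ∧ (S = 2 → n = 1)
  after n s := s.val = S - 1 ∧ (S = 2 → n = 0)
  disjoint x hx hy := by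
    rw [mem_heapExits] at hx hy
    omega
  before_start := by
    refine ⟨by simp only; omega, ?_⟩
    rintro rfl
    simp
  before_step n s a := by
    rintro ⟨hs, hn⟩
    simp only [mem_heapExits, Nat.sub_zero, Nat.zero_add]
    by_cases h : A * s.val + a.val + 1 < S / 2
    · have : (heapNext hS s a).val = A * s.val + a.val + 1 := by simp [heapNext, hs, h]
      rw [this]
      exact Or.inl ⟨⟨by omega, by omega⟩, h, by omega⟩
    · have : (heapNext hS s a).val = S / 2 := by simp [heapNext, hs, h]
      rw [this]
      have : 0 < secondSize S := by simp [secondSize]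
      exact Or.inr ⟨by omega, by omega, by omega, by omega⟩
  between_step n s a := by
    rintro ⟨hs, hs', hn⟩
    simp only [mem_heapExits, Nat.sub_zero, Nat.zero_add]
    by_cases h : A * (s.val - S / 2) + a.val + 1 < secondSize S
    · have : (heapNext hS s a).val = S / 2 + (A * (s.val - S / 2) + a.val + 1) := by
        simp [heapNext, hs', h, not_lt.2 hs]
      rw [this]
      have hS2 : S ≠ 2 := by
        rintro rfl
        simp [secondSize] at h
      exact Or.inl ⟨⟨by omega, by omega⟩, by omega, by omega, by omega⟩
    · have : (heapNext hS s a).val = S - 1 := by simp [heapNext, h, not_lt.2 hs]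
      rw [this]
      exact Or.inr ⟨by omega, rfl, by omega⟩
  after_step n s a := by
    rintro ⟨hs, hn⟩
    have hS2 : 3 ≤ S := by omega
    have hsz : S / 2 + secondSize S = S - 1 := by
      simp only [secondSize]
      omega
    have : (heapNext hS s a).val = S - 1 := by
      have h1 : ¬ s.val < S / 2 := by omega
      have h2 : ¬ s.val < S / 2 + secondSize S := by omega
      simp [heapNext, h1, h2]
    simp only [mem_heapExits]
    exact ⟨⟨by omega, by omega⟩, this, by omega⟩
  reach x hx y hy := by
    rw [mem_heapExits] at hx hy
    rw [Nat.zero_add, Nat.sub_zero] at hx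
    have hA1 : 1 < A := by omega
    -- The second heap is no larger than the first, so the same depth bound serves for both legs.
    have hsz : secondSize S ≤ S / 2 := by
      simp only [secondSize]
      omega
    obtain ⟨g₁, u, hu, hux, gx, hpath₁⟩ := (isHeap_first (A := A) hS).exists_path
      (root := ⟨0, by omega⟩) rfl (Nat.clog A (S / 2)) x.1 x.2 (Nat.zero_le _) (by omega)
      (lt_of_lt_of_le (by omega) (Nat.le_pow_clog hA1 (S / 2)))
    obtain ⟨g₂, v, hv, hvy, gy, hpath₂⟩ := (isHeap_second (A := A) hS).exists_path
      (root := ⟨S / 2, by omega⟩) rfl (Nat.clog A (S / 2)) y.1 y.2 hy.1 (by omega)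
      (lt_of_lt_of_le (by omega) (Nat.le_pow_clog hA1 (S / 2)))
    have hxnext : heapNext hS x.1 x.2 = ⟨S / 2, by omega⟩ := by
      have : ¬ A * x.1.val + x.2.val + 1 < S / 2 := by omega
      simp [heapNext, hx.2.1, this]
    set g : Fin S → Fin A := fun s => if s.val < S / 2 then g₁ s else g₂ s with hg
    have e₁ : ∀ s : Fin S, s.val < S / 2 → g s = g₁ s := fun s hs => if_pos hs
    have e₂ : ∀ s : Fin S, S / 2 ≤ s.val → g s = g₂ s := fun s hs => if_neg (not_lt.2 hs)
    have c₁ := iterate_eq_of_forall_lt (f := fun s => heapNext hS s (g₁ s))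
      (f' := fun s => heapNext hS s (g s)) (s := ⟨0, by omega⟩) (t := u) fun j hj => by
        rw [e₁ _ ((hpath₁ j hj).2.1.trans hx.2.1)]
    have c₂ := iterate_eq_of_forall_lt (f := fun s => heapNext hS s (g₂ s))
      (f' := fun s => heapNext hS s (g s)) (s := ⟨S / 2, by omega⟩) (t := v) fun j hj => by
        rw [e₂ _ (hpath₂ j hj).1]
    refine ⟨g, u, v, by omega, ?_, (c₁ u le_rfl).trans hux, (e₁ _ hx.2.1).trans gx, ?_, ?_,
      (e₂ _ hy.1).trans gy⟩
    · intro i hi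
      rw [c₁ i hi.le, e₁ _ ((hpath₁ i hi).2.1.trans hx.2.1)]
      exact (hpath₁ i hi).2.2
    · intro i hi
      rw [hxnext, c₂ i hi.le, e₂ _ (hpath₂ i hi).1]
      exact (hpath₂ i hi).2.2
    · rw [hxnext]
      exact (c₂ v le_rfl).trans hvy

/-- As `A ≥ 3`, a heap with `n` nodes has at least `n * A - n + 1` exits, so at least 3 and at least
two thirds of `n * A`. The sizes satisfy `S ≤ 3 * (S / 2)` and `S ≤ 4 * secondSize S`. -/
theorem le_card_mul_card (hS : 2 ≤ S) (hA : 3 ≤ A) :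
    9 ≤ (heapLayout hS hA).first.card * (heapLayout hS hA).second.card ∧
      S ^ 2 * A ^ 2 ≤
        27 * ((heapLayout hS hA).first.card * (heapLayout hS hA).second.card) := by
  have key : ∀ n c : ℕ, 0 < n → n * A + 1 - n ≤ c → 3 ≤ c ∧ 2 * (n * A) ≤ 3 * c := by
    intro n c hn hc
    have h1 : n * 3 ≤ n * A := Nat.mul_le_mul_left n hA
    exact ⟨by omega, by omega⟩
  obtain ⟨a1, a2⟩ := key (S / 2) _ (by omega)
    (le_card_heapExits (S := S) (A := A) (o := 0) (by omega) (by omega) (by omega))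
  have hsz : 0 < secondSize S ∧ S / 2 + secondSize S ≤ S ∧ S ≤ 4 * secondSize S := by
    simp only [secondSize]
    omega
  obtain ⟨b1, b2⟩ := key (secondSize S) _ hsz.1
    (le_card_heapExits (S := S) (A := A) (o := S / 2) (by omega) hsz.2.1 hsz.1)
  refine ⟨Nat.mul_le_mul a1 b1, ?_⟩
  change S ^ 2 * A ^ 2 ≤
    27 * ((heapExits S A 0 (S / 2)).card * (heapExits S A (S / 2) (secondSize S)).card)
  set p := (heapExits S A 0 (S / 2)).card
  set q := (heapExits S A (S / 2) (secondSize S)).card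
  have h1 : S * A ≤ 3 * (S / 2) * A := Nat.mul_le_mul_right A (by omega)
  have h2 : S * A ≤ 4 * secondSize S * A := Nat.mul_le_mul_right A hsz.2.2
  have h3 : 2 * (S * A) ≤ 9 * p := by nlinarith
  have h4 : S * A ≤ 6 * q := by nlinarith
  have h5 := Nat.mul_le_mul h3 h4
  nlinarith
end RewardMixing

end

/-! ### The lower bound -/

theorem theorem2 :
    ∃ c : ℝ, 0 < c ∧ ∃ ε₀ : ℝ, 0 < ε₀ ∧
      ∀ S A : ℕ, 2 ≤ S → 3 ≤ A →
        ∃ H : ℕ, H ≤ 2 * (1 + Nat.clog A (S / 2)) ∧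
          ∀ ε : ℝ, 0 < ε → ε ≤ ε₀ →
            ∃ 𝒞 : Set (RewardMixing.RMMDP 2 (Fin S) (Fin A)),
              (∀ 𝓜 ∈ 𝒞, RewardMixing.IsUniform2RM 𝓜) ∧
              ∀ η : ℝ, 0 < η → η ≤ 1 / 4 →
                ∀ alg : RewardMixing.Algorithm (Fin S) (Fin A),
                  (∀ 𝓜 ∈ 𝒞, alg.IsPAC 𝓜 H ε η) →
                  ∃ 𝓜 ∈ 𝒞, ∀ K : ℕ,
                    (K : ℝ) < c * ((S : ℝ) ^ 2 * (A : ℝ) ^ 2 / ε ^ 2) →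
                    1 / 2 ≤ alg.probMoreThan 𝓜 H K := by
  -- For a number `N ≥ 9` of combinations, `N / 4 - 2 ≥ N / 36`; with `S ^ 2 * A ^ 2 ≤ 27 * N` this
  -- asks for `c ≤ 1 / (36 * 27 * 512)`, and the denominator is just below 500000. The bound `1 /
  -- 16` keeps `8 * ε ≤ 1 / 2`.
  refine ⟨1 / 500000, by norm_num, 1 / 16, by norm_num, fun S A hS hA =>
    ⟨2 * (1 + Nat.clog A (S / 2)), le_rfl, fun ε hε hε' => ?_⟩⟩
  let L := RewardMixing.heapLayout hS hA
  have : Nontrivial (Fin A) := Fin.nontrivial_iff_two_le.2 (by omega)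
  refine ⟨{𝓜 | ∃ x ∈ L.first, ∃ y ∈ L.second, 𝓜 = L.hardModel ε x y}, ?_, ?_⟩
  · rintro _ ⟨x, -, y, -, rfl⟩
    exact RewardMixing.isUniform2RM_detModel _ _ _
  intro η _ hη alg hpac
  by_contra! hcon
  set B : ℝ := 1 / 500000 * ((S : ℝ) ^ 2 * (A : ℝ) ^ 2 / ε ^ 2) with hB
  have hS0 : (0 : ℝ) < S := by exact_mod_cast (by omega : 0 < S)
  have hA0 : (0 : ℝ) < A := by exact_mod_cast (by omega : 0 < A)
  have hB0 : 0 < B := by positivity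
  -- The largest integer below `B`: by monotonicity this one `K` serves for all instances, although
  -- the assumed violations occur at different `K'`.
  set K := ⌈B⌉₊ - 1 with hKdef
  have hKB : (K : ℝ) < B := Nat.lt_ceil.1 (by have := Nat.ceil_pos.2 hB0; omega)
  have hcard := L.card_mul_card_le alg hε hε' hη K
    (fun x hx y hy => hpac _ ⟨x, hx, y, hy, rfl⟩) fun x hx y hy => by
      obtain ⟨K', hK', hlt⟩ := hcon _ ⟨x, hx, y, hy, rfl⟩
      refine lt_of_le_of_lt (alg.probMoreThan_antitone _ _ ?_) hlt
      have := Nat.lt_ceil.2 hK'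
      omega
  obtain ⟨h9, h27⟩ := RewardMixing.le_card_mul_card hS hA
  have h9' : (9 : ℝ) ≤ L.first.card * L.second.card := by exact_mod_cast h9
  have h27' : (S : ℝ) ^ 2 * (A : ℝ) ^ 2 ≤ 27 * (L.first.card * L.second.card) := by
    exact_mod_cast h27
  have hBε : ε ^ 2 * B = 1 / 500000 * ((S : ℝ) ^ 2 * (A : ℝ) ^ 2) := by
    rw [hB]
    field_simp
  have hKε : ε ^ 2 * K < ε ^ 2 * B := mul_lt_mul_of_pos_left hKB (by positivity)
  have hpos : 0 < (S : ℝ) ^ 2 * (A : ℝ) ^ 2 := by positivity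
  linarith
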